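/- Let $n,m\ge 1$ and let $\mathcal A=(a_{ij})\in\mathbb R^{n\times n}$ be the weighted adjacency matrix of an undirected connected graph $\mathcal G$ on the sensors $\{1,\dots,n\}$: $a_{ij}=a_{ji}\ge 0$, $a_{ii}>0$, $\sum_j a_{ij}=1$, and $i\neq j$ are joined by an edge iff $a_{ij}>0$. Let $\mathcal N_i=\{j: a_{ji}>0\}$, let $D_{\mathcal G}$ be the diameter of $\mathcal G$, and let $a_{\min}$ be the smallest entry of $\mathcal A^{D_{\mathcal G}}$. On a probability space, let $\theta_t\in\mathbb R^m$ ($t\ge 0$) be random parameters, $w_{t,i}$ real random noises, $\varphi_{t,i}\in\mathbb R^m$ random regressors, and let the observations satisfy $y_{t+1,i}=\varphi_{t,i}^T\theta_t+w_{t+1,i}$ for $t\ge0$. Given $\alpha\in(0,1)$, deterministic positive definite matrices $P_{0,i}$ and initial estimates $\hat\theta_{0,i}$, the diffusion forgetting-factor least squares (FFLS) algorithm is, for $t\ge 0$, $$\bar\theta_{t+1,i}=\hat\theta_{t,i}+\frac{P_{t,i}\varphi_{t,i}}{\alpha+\varphi_{t,i}^TP_{t,i}\varphi_{t,i}}\,(y_{t+1,i}-\varphi_{t,i}^T\hat\theta_{t,i}),\qquad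 \bar P_{t+1,i}=\frac1\alpha\Big(P_{t,i}-\frac{P_{t,i}\varphi_{t,i}\varphi_{t,i}^TP_{t,i}}{\alpha+\varphi_{t,i}^TP_{t,i}\varphi_{t,i}}\Big),$$ $$P_{t+1,i}^{-1}=\sum_{j\in\mathcal N_i}a_{ij}\bar P_{t+1,j}^{-1},\qquad \hat\theta_{t+1,i}=P_{t+1,i}\sum_{j\in\mathcal N_i}a_{ij}\bar P_{t+1,j}^{-1}\bar\theta_{t+1,j}.$$ Write $\widetilde\Theta_t=\mathrm{col}(\theta_t-\hat\theta_{t,1},\dots,\theta_t-\hat\theta_{t,n})$, $W_t=\mathrm{col}(w_{t,1},\dots,w_{t,n})$, $\Delta\Theta_t=\mathrm{col}(\theta_{t+1}-\theta_t,\dots,\theta_{t+1}-\theta_t)$ ($n$ copies), and $\|X\|_{L_q}=(\mathbb E\|X\|^q)^{1/q}$ with $\|\cdot\|$ the Euclidean norm. Assume that for each $i$ the sequence $(\varphi_{t,i})_{t\ge0}$ is adapted to a filtration $(\mathscr F_t)_{t\ge0}$, and that there are an integer $h>0$ and $\lambda\in(0,1)$ such that, with $$\lambda_t=\lambda_{\min}\Big[\mathbb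 E\Big(\frac1{n(1+h)}\sum_{i=1}^n\sum_{k=th+1}^{(t+1)h}\frac{\varphi_{k,i}\varphi_{k,i}^T}{1+\|\varphi_{k,i}\|^2}\,\Big|\,\mathscr F_{th}\Big)\Big],$$ one has $1-\lambda_t\in[0,1)$ almost surely for all $t$, and for some $M>0$, $\mathbb E\prod_{j=k+1}^t(1-\lambda_j)\le M\lambda^{t-k}$ for all $t\ge k\ge 0$. Let $p\ge1$, and assume $\sup_t\|\varphi_{t,i}\|_{L_{6p}}<\infty$ for every $i$ and $$\lambda^{\frac{a_{\min}^2}{32\,p\,m\,h\,(4h+D_{\mathcal G}-1)}}<\alpha<1 .$$ Then there is a constant $c>0$, not depending on the processes $(\theta_t)$, $(w_{t,i})$ or on the $\hat\theta_{0,i}$, such that whenever $\|\widetilde\Theta_0\|_{L_p}<\infty$ and $\sigma_{3p}:=\sup_{t\ge0}\big(\|W_t\|_{L_{3p}}+\|\Delta\Theta_t\|_{L_{3p}}\big)<\infty$, $$\limsup_{t\to\infty}\|\widetilde\Theta_t\|_{L_p}\le c\,\sigma_{3p}.$$ -/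

import Mathlib

open MeasureTheory ProbabilityTheory Filter

open scoped Matrix ENNReal

noncomputable section

namespace DiffusionFFLS

/-- The space `ℝᵐ` with its Euclidean norm. -/
abbrev Vec (m : ℕ) : Type := EuclideanSpace ℝ (Fin m)

/-- A weighted undirected graph on the sensors `Fin n`, given by its weighted adjacency matrix:
the weights are nonnegative (`i` and `j` are joined iff the weight is positive) and symmetric,
each row sums to one, and every sensor is a neighbor of itself. -/
structure Network (n : ℕ) where
  weight : Matrix (Fin n) (Fin n) ℝ
  nonneg : ∀ i j, 0 ≤ weight i j
  symm : ∀ i j, weight i j = weight j i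
  row_sum : ∀ i, ∑ j, weight i j = 1
  self_pos : ∀ i, 0 < weight i i

namespace Network

variable {n : ℕ} (G : Network n)

/-- The underlying simple graph: the edges between distinct sensors. -/
def graph : SimpleGraph (Fin n) where
  Adj i j := i ≠ j ∧ 0 < G.weight i j
  symm := ⟨fun i j hij => ⟨hij.1.symm, by rw [G.symm j i]; exact hij.2⟩⟩
  loopless := ⟨fun _ hi => hi.1 rfl⟩

/-- The neighbor set of the sensor `i`, which contains `i` itself. -/
def nbhd (i : Fin n) : Finset (Fin n) := {j | 0 < G.weight j i}

/-- The diameter: the largest graph distance between two sensors. -/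
def diameter : ℕ := G.graph.diam

/-- The smallest entry of the power of the adjacency matrix whose exponent is the diameter. -/
def aMin : ℝ := ⨅ ij : Fin n × Fin n, (G.weight ^ G.diameter) ij.1 ij.2

end Network

/-! ### The diffusion algorithm, along one trajectory of the data -/

section Algorithm

variable {n m : ℕ}

/-- The gain `P φ / (α + φᵀ P φ)`. -/
def gain (α : ℝ) (P : Matrix (Fin m) (Fin m) ℝ) (φ : Vec m) : Vec m :=
  WithLp.toLp 2 ((α + φ.ofLp ⬝ᵥ P *ᵥ φ.ofLp)⁻¹ • (P *ᵥ φ.ofLp))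

/-- Adaptation of the estimate: `θ + P φ / (α + φᵀ P φ) * (y - φᵀ θ)`. -/
def adaptEst (α : ℝ) (P : Matrix (Fin m) (Fin m) ℝ) (φ : Vec m) (y : ℝ) (θ : Vec m) : Vec m :=
  θ + (y - φ.ofLp ⬝ᵥ θ.ofLp) • gain α P φ

/-- Adaptation of the matrix: `(1 / α) * (P - P φ φᵀ P / (α + φᵀ P φ))`. -/
def adaptMat (α : ℝ) (P : Matrix (Fin m) (Fin m) ℝ) (φ : Vec m) : Matrix (Fin m) (Fin m) ℝ :=
  α⁻¹ • (P - (α + φ.ofLp ⬝ᵥ P *ᵥ φ.ofLp)⁻¹ • (P * Matrix.vecMulVec φ.ofLp φ.ofLp * P))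

variable (G : Network n) (α : ℝ) (P₀ : Fin n → Matrix (Fin m) (Fin m) ℝ) (θ₀ : Fin n → Vec m)
  (φ : ℕ → Fin n → Vec m) (y : ℕ → Fin n → ℝ)

/-- The matrices `P t i`: the inverse of `P (t + 1) i` is the weighted average of the inverses of
the adapted matrices of the neighbors of `i`. -/
def gainMat : ℕ → Fin n → Matrix (Fin m) (Fin m) ℝ
  | 0 => P₀
  | t + 1 => fun i =>
      (∑ j ∈ G.nbhd i, G.weight i j • (adaptMat α (gainMat t j) (φ t j))⁻¹)⁻¹

/-- The estimates `θ̂ t i` of the diffusion forgetting-factor least squares algorithm. -/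
def estimate : ℕ → Fin n → Vec m
  | 0 => θ₀
  | t + 1 => fun i =>
      WithLp.toLp 2 (gainMat G α P₀ φ (t + 1) i *ᵥ
        ∑ j ∈ G.nbhd i, G.weight i j •
          ((adaptMat α (gainMat G α P₀ φ t j) (φ t j))⁻¹ *ᵥ
            (adaptEst α (gainMat G α P₀ φ t j) (φ t j) (y (t + 1) j) (estimate t j)).ofLp))

end Algorithm

/-! ### Stacked vectors -/

/-- The column vector obtained by stacking `n` vectors of `ℝᵐ`, with the Euclidean norm of
`ℝ^(nm)`. -/
def stack {n m : ℕ} (v : Fin n → Vec m) : EuclideanSpace ℝ (Fin n × Fin m) :=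
  WithLp.toLp 2 fun ij => v ij.1 ij.2

section Probability

variable {Ω : Type*} [mΩ : MeasurableSpace Ω]

/-- The `L_q` norm `(E ‖X‖^q)^(1/q)` of a random vector, as an extended nonnegative real. -/
def LNorm {E : Type*} [NormedAddCommGroup E] (μ : Measure Ω) (q : ℝ) (X : Ω → E) : ℝ≥0∞ :=
  eLpNorm X (ENNReal.ofReal q) μ

/-- `sup_t ‖X_t‖_{L_q}` for a sequence of random vectors. -/
def supLNorm {E : Type*} [NormedAddCommGroup E] (μ : Measure Ω) (q : ℝ) (X : ℕ → Ω → E) : ℝ≥0∞ :=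
  ⨆ t, LNorm μ q (X t)

/-- The class `S⁰(lam)`: random sequences with values in `[0, 1)` such that, for some `M > 0`,
`E (∏_{j = k + 1}^t a_j) ≤ M lam ^ (t - k)` for all `t ≥ k ≥ 0`. -/
def SZero (μ : Measure Ω) (lam : ℝ) (a : ℕ → Ω → ℝ) : Prop :=
  (∀ t, AEMeasurable (a t) μ) ∧ (∀ t, ∀ᵐ ω ∂μ, a t ω ∈ Set.Ico (0 : ℝ) 1) ∧
    ∃ M : ℝ, 0 < M ∧ ∀ k t : ℕ, k ≤ t →
      ∫ ω, ∏ j ∈ Finset.Icc (k + 1) t, a j ω ∂μ ≤ M * lam ^ (t - k)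

/-- The conditional expectation of a random matrix, taken entrywise. -/
def condExpMat {m : ℕ} (μ : Measure Ω) (𝓖 : MeasurableSpace Ω)
    (X : Ω → Matrix (Fin m) (Fin m) ℝ) (ω : Ω) : Matrix (Fin m) (Fin m) ℝ :=
  Matrix.of fun a b => (μ[fun ω' => X ω' a b | 𝓖]) ω

/-- The smallest eigenvalue of a real symmetric matrix. -/
def lambdaMin {m : ℕ} (X : Matrix (Fin m) (Fin m) ℝ) : ℝ := sInf (spectrum ℝ X)

/-- The normalized information matrix of all sensors over the time block
`t h + 1, …, (t + 1) h`. -/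
def blockInfo {n m : ℕ} (h : ℕ) (φ : ℕ → Fin n → Ω → Vec m) (t : ℕ) (ω : Ω) :
    Matrix (Fin m) (Fin m) ℝ :=
  ((n : ℝ) * (1 + (h : ℝ)))⁻¹ • ∑ i, ∑ k ∈ Finset.Icc (t * h + 1) ((t + 1) * h),
    (1 + ‖φ k i ω‖ ^ 2)⁻¹ • Matrix.vecMulVec (φ k i ω).ofLp (φ k i ω).ofLp

/-- The excitation level of block `t`: the smallest eigenvalue of the conditional expectation of
the normalized information matrix given the past up to time `t h`. -/
def excitation {n m : ℕ} (μ : Measure Ω) (𝓕 : Filtration ℕ mΩ) (h : ℕ)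
    (φ : ℕ → Fin n → Ω → Vec m) (t : ℕ) (ω : Ω) : ℝ :=
  lambdaMin (condExpMat μ (𝓕 (t * h)) (blockInfo h φ t) ω)

/-- The cooperative excitation condition with block length `h` and rate `lam`. -/
def CooperativeExcitation {n m : ℕ} (μ : Measure Ω) (𝓕 : Filtration ℕ mΩ) (h : ℕ) (lam : ℝ)
    (φ : ℕ → Fin n → Ω → Vec m) : Prop :=
  (∀ i, StronglyAdapted 𝓕 fun t => φ t i) ∧
    SZero μ lam fun t ω => 1 - excitation μ 𝓕 h φ t ω

/-- `sup_t (‖W_t‖_{L_q} + ‖ΔΘ_t‖_{L_q})`, where `W_t` collects the noises of all sensors and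
`ΔΘ_t` consists of `n` copies of `θ_{t+1} - θ_t`. -/
def disturbanceLevel {n m : ℕ} (μ : Measure Ω) (q : ℝ) (w : ℕ → Fin n → Ω → ℝ)
    (θ : ℕ → Ω → Vec m) : ℝ≥0∞ :=
  ⨆ t : ℕ, (LNorm μ q (fun ω => (WithLp.toLp 2 fun i => w t i ω : Vec n)) +
    LNorm μ q (fun ω => stack fun _ : Fin n => θ (t + 1) ω - θ t ω))

/-- The stacked tracking error `Θ̃_t = col (θ_t - θ̂_{t,1}, …, θ_t - θ̂_{t,n})`. -/
def trackingError {n m : ℕ} (G : Network n) (α : ℝ) (P₀ : Fin n → Matrix (Fin m) (Fin m) ℝ)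
    (θ₀ : Fin n → Ω → Vec m) (φ : ℕ → Fin n → Ω → Vec m) (y : ℕ → Fin n → Ω → ℝ)
    (θ : ℕ → Ω → Vec m) (t : ℕ) (ω : Ω) : EuclideanSpace ℝ (Fin n × Fin m) :=
  stack fun i => θ t ω -
    estimate G α P₀ (fun j => θ₀ j ω) (fun s j => φ s j ω) (fun s j => y s j ω) t i

end Probability

end DiffusionFFLS

end

noncomputable section

namespace DiffusionFFLS

/-! ### Linear recursions for the information matrices and the transformed errors -/

section Algebra

variable {n m : ℕ}

/-! Write R for the inverse of the gain matrix and z = R(θ - θ̂) for the transformed error of a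
sensor. By Sherman–Morrison both obey linear recursions: R is averaged over neighbors, multiplied by
α and fed with φφᵀ (`infoMat_succ`), while z is averaged, multiplied by α and fed with R Δθ and w φ
(`infoMat_mulVec_error_succ`). The averaging is row-stochastic, so z is at most α^t times the
initial error plus a geometric sum of disturbances (`infoMat_error_le`). No excitation is needed
here: φ in L_{6p} puts R in L_{3p}, so the accumulated disturbance lies in L_{3p/2} with norm of
order σ_{3p}.

It remains to return from z to the error, ‖θ - θ̂‖ ≤ Γ‖z‖, with a random Γ bounded in L_{3p}; Hölder
with 1/(3p) + 2/(3p) = 1/p then finishes. This needs a lower bound of R. Data older than the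
diameter reach each sensor with weight at least a_min, so R dominates the sum of the block
information matrices over the last r blocks, up to a factor of order α^{hr} (`infoMat_quad_lower`).
Hence Γ is of order α^{-hr} for the shortest window r that excites all directions
(`norm_le_gainBound`).

For one direction, an exponential supermartingale bounds the probability that r blocks are
insufficient by a multiple of ρ^r, where ρ = λ^{1/(4h+1)} (`measure_small_sum_le`,
`measure_direction_le`). A union bound over an integer grid with polynomially many points in r
extends this to all directions (`quad_lower_of_notMem`). The L_{3p} norm of Γ is then bounded by a
series of ratio ρ^{1/(3p)} α^{-h}, and the assumption on α makes this ratio less than one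
(`rate_lt_forgetting`).

The initial error has only p moments, so Hölder cannot be applied to it. Its factor is both at most
Γ α^t, which tends to zero almost surely, and at most a constant; dominated convergence removes it.
-/

lemma posSemidef_vecMulVec (v : Fin m → ℝ) : (Matrix.vecMulVec v v).PosSemidef := by
  simpa using Matrix.posSemidef_vecMulVec_self_star v

lemma denom_pos {α : ℝ} (hα : 0 < α) {P : Matrix (Fin m) (Fin m) ℝ} (hP : P.PosDef)
    (φ : Vec m) : 0 < α + φ.ofLp ⬝ᵥ P *ᵥ φ.ofLp := by
  have := hP.posSemidef.dotProduct_mulVec_nonneg φ.ofLp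
  simp only [star_trivial] at this
  linarith

/-- The Sherman–Morrison formula for the adapted matrix. -/
lemma adaptMat_inv {α : ℝ} (hα : 0 < α) {P : Matrix (Fin m) (Fin m) ℝ} (hP : P.PosDef)
    (φ : Vec m) :
    (adaptMat α P φ)⁻¹ = α • P⁻¹ + Matrix.vecMulVec φ.ofLp φ.ofLp := by
  have hd := denom_pos hα hP φ
  have hU : P * P⁻¹ = 1 := Matrix.mul_nonsing_inv _ ((Matrix.isUnit_iff_isUnit_det _).1 hP.isUnit)
  have h3 : Matrix.vecMulVec φ.ofLp φ.ofLp * P * Matrix.vecMulVec φ.ofLp φ.ofLp =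
      (φ.ofLp ⬝ᵥ P *ᵥ φ.ofLp) • Matrix.vecMulVec φ.ofLp φ.ofLp := by
    rw [Matrix.mul_assoc, Matrix.mul_vecMulVec, Matrix.vecMulVec_mul_vecMulVec,
      Matrix.vecMulVec_smul']
    rw [op_smul_eq_smul, Matrix.smul_vecMulVec]
  apply Matrix.inv_eq_right_inv
  set d := φ.ofLp ⬝ᵥ P *ᵥ φ.ofLp
  set V := Matrix.vecMulVec φ.ofLp φ.ofLp
  have e1 : P * V * P * P⁻¹ = P * V := by rw [Matrix.mul_assoc, hU, Matrix.mul_one]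
  have e2 : P * V * P * V = d • (P * V) := by
    rw [Matrix.mul_assoc, Matrix.mul_assoc, ← Matrix.mul_assoc V, h3, Matrix.mul_smul]
  have : adaptMat α P φ * (α • P⁻¹ + V) =
      1 + (α⁻¹ * (1 - (α + d)⁻¹ * α - (α + d)⁻¹ * d)) • (P * V) := by
    have hA : adaptMat α P φ = α⁻¹ • (P - (α + d)⁻¹ • (P * V * P)) := rfl
    simp only [hA, Matrix.smul_mul, Matrix.mul_add, Matrix.sub_mul, Matrix.mul_smul, hU, e1, e2]
    match_scalars <;> field_simp
    ring
  rw [this]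
  have : (1 - (α + d)⁻¹ * α - (α + d)⁻¹ * d) = 0 := by field_simp; ring
  rw [this]; simp

/-- The adapted inverse sends P φ to (α + φᵀPφ) φ, which cancels the denominator of the gain. The
innovation thus enters the transformed recursion along φ, free of P. -/
lemma adaptMat_inv_mulVec_gain {α : ℝ} (hα : 0 < α) {P : Matrix (Fin m) (Fin m) ℝ}
    (hP : P.PosDef) (φ : Vec m) :
    (adaptMat α P φ)⁻¹ *ᵥ (gain α P φ).ofLp = φ.ofLp := by
  have hd := denom_pos hα hP φ
  have hU : P⁻¹ * P = 1 := Matrix.nonsing_inv_mul _ ((Matrix.isUnit_iff_isUnit_det _).1 hP.isUnit)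
  rw [adaptMat_inv hα hP, gain]
  rw [WithLp.ofLp_toLp, Matrix.mulVec_smul, Matrix.add_mulVec, Matrix.smul_mulVec,
    Matrix.mulVec_mulVec, hU, Matrix.one_mulVec, Matrix.vecMulVec_mulVec, op_smul_eq_smul,
    ← add_smul, smul_smul, inv_mul_cancel₀ hd.ne', one_smul]

lemma adaptMat_inv_posDef {α : ℝ} (hα : 0 < α) {P : Matrix (Fin m) (Fin m) ℝ}
    (hP : P.PosDef) (φ : Vec m) : (adaptMat α P φ)⁻¹.PosDef := by
  rw [adaptMat_inv hα hP]
  exact (hP.inv.smul hα).add_posSemidef (posSemidef_vecMulVec _)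

lemma sum_nbhd {E : Type*} [AddCommGroup E] [Module ℝ E] (G : Network n) (i : Fin n)
    (f : Fin n → E) : ∑ j ∈ G.nbhd i, G.weight i j • f j = ∑ j, G.weight i j • f j := by
  apply Finset.sum_subset (Finset.subset_univ _)
  intro j _ hj
  have h1 : G.weight j i = 0 := by
    simp only [Network.nbhd, Finset.mem_filter, Finset.mem_univ, true_and, not_lt] at hj
    exact le_antisymm hj (G.nonneg _ _)
  rw [G.symm, h1, zero_smul]

lemma sum_weight_posDef (G : Network n) (i : Fin n) {X : Fin n → Matrix (Fin m) (Fin m) ℝ}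
    (hX : ∀ j, (X j).PosDef) : (∑ j, G.weight i j • X j).PosDef := by
  -- Definiteness comes from the positive self-weight; the other terms are only semidefinite.
  rw [← Finset.add_sum_erase _ _ (Finset.mem_univ i)]
  exact ((hX i).smul (G.self_pos i)).add_posSemidef
    (Matrix.posSemidef_sum _ fun j _ => (hX j).posSemidef.smul (G.nonneg i j))

variable (G : Network n) {α : ℝ} {P₀ : Fin n → Matrix (Fin m) (Fin m) ℝ}

lemma gainMat_posDef (hα : 0 < α) (hP₀ : ∀ i, (P₀ i).PosDef) (φ : ℕ → Fin n → Vec m) (t : ℕ)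
    (i : Fin n) : (gainMat G α P₀ φ t i).PosDef := by
  induction t generalizing i with
  | zero => exact hP₀ i
  | succ t ih =>
    simp only [gainMat, sum_nbhd]
    exact (sum_weight_posDef G i fun j => adaptMat_inv_posDef hα (ih j) _).inv

/-- The information matrix, the inverse of the gain matrix. -/
def infoMat (G : Network n) (α : ℝ) (P₀ : Fin n → Matrix (Fin m) (Fin m) ℝ)
    (φ : ℕ → Fin n → Vec m) (t : ℕ) (i : Fin n) : Matrix (Fin m) (Fin m) ℝ :=
  (gainMat G α P₀ φ t i)⁻¹

lemma infoMat_posDef (hα : 0 < α) (hP₀ : ∀ i, (P₀ i).PosDef) (φ : ℕ → Fin n → Vec m) (t : ℕ)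
    (i : Fin n) : (infoMat G α P₀ φ t i).PosDef :=
  (gainMat_posDef G hα hP₀ φ t i).inv

lemma infoMat_succ (hα : 0 < α) (hP₀ : ∀ i, (P₀ i).PosDef) (φ : ℕ → Fin n → Vec m) (t : ℕ)
    (i : Fin n) :
    infoMat G α P₀ φ (t + 1) i = ∑ j, G.weight i j •
      (α • infoMat G α P₀ φ t j + Matrix.vecMulVec (φ t j).ofLp (φ t j).ofLp) := by
  simp only [infoMat, gainMat, sum_nbhd]
  rw [Matrix.nonsing_inv_nonsing_inv]
  · exact Finset.sum_congr rfl fun j _ => by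
      rw [adaptMat_inv hα (gainMat_posDef G hα hP₀ φ t j)]
  · exact (Matrix.isUnit_iff_isUnit_det _).1 (sum_weight_posDef G i fun j =>
      adaptMat_inv_posDef hα (gainMat_posDef G hα hP₀ φ t j) _).isUnit

/-- The information matrices turn the recursion of the tracking errors into a linear one. -/
lemma infoMat_mulVec_error_succ (hα : 0 < α) (hP₀ : ∀ i, (P₀ i).PosDef) (φ : ℕ → Fin n → Vec m)
    (θ₀ : Fin n → Vec m) (y w : ℕ → Fin n → ℝ) (θ : ℕ → Vec m)
    (hy : ∀ t i, y (t + 1) i = (φ t i).ofLp ⬝ᵥ (θ t).ofLp + w (t + 1) i) (t : ℕ) (i : Fin n) :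
    infoMat G α P₀ φ (t + 1) i *ᵥ (θ (t + 1) - estimate G α P₀ θ₀ φ y (t + 1) i).ofLp =
      infoMat G α P₀ φ (t + 1) i *ᵥ (θ (t + 1) - θ t).ofLp +
      ∑ j, G.weight i j • (α • (infoMat G α P₀ φ t j *ᵥ
        (θ t - estimate G α P₀ θ₀ φ y t j).ofLp) - w (t + 1) j • (φ t j).ofLp) := by
  have hU : infoMat G α P₀ φ (t + 1) i * gainMat G α P₀ φ (t + 1) i = 1 :=
    Matrix.nonsing_inv_mul _
      ((Matrix.isUnit_iff_isUnit_det _).1 (gainMat_posDef G hα hP₀ φ (t + 1) i).isUnit)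
  have h1 : infoMat G α P₀ φ (t + 1) i *ᵥ (estimate G α P₀ θ₀ φ y (t + 1) i).ofLp =
      ∑ j, G.weight i j • ((α • infoMat G α P₀ φ t j +
        Matrix.vecMulVec (φ t j).ofLp (φ t j).ofLp) *ᵥ (estimate G α P₀ θ₀ φ y t j).ofLp +
        (y (t + 1) j - (φ t j).ofLp ⬝ᵥ (estimate G α P₀ θ₀ φ y t j).ofLp) • (φ t j).ofLp) := by
    rw [estimate, Matrix.mulVec_mulVec, hU, Matrix.one_mulVec, sum_nbhd]
    refine Finset.sum_congr rfl fun j _ => ?_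
    have hP := gainMat_posDef G hα hP₀ φ t j
    rw [adaptEst, WithLp.ofLp_add, WithLp.ofLp_smul, Matrix.mulVec_add, Matrix.mulVec_smul,
      adaptMat_inv_mulVec_gain hα hP, adaptMat_inv hα hP, infoMat]
  have h2 : infoMat G α P₀ φ (t + 1) i *ᵥ (θ t).ofLp =
      ∑ j, G.weight i j • ((α • infoMat G α P₀ φ t j +
        Matrix.vecMulVec (φ t j).ofLp (φ t j).ofLp) *ᵥ (θ t).ofLp) := by
    rw [infoMat_succ G hα hP₀, Matrix.sum_mulVec]
    exact Finset.sum_congr rfl fun j _ => by rw [Matrix.smul_mulVec]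
  have h3 : (θ (t + 1) - estimate G α P₀ θ₀ φ y (t + 1) i).ofLp =
      (θ (t + 1) - θ t).ofLp + (θ t).ofLp - (estimate G α P₀ θ₀ φ y (t + 1) i).ofLp := by
    simp
  rw [h3, Matrix.mulVec_sub, Matrix.mulVec_add, h1, h2, add_sub_assoc, ← Finset.sum_sub_distrib]
  congr 1
  refine Finset.sum_congr rfl fun j _ => ?_
  rw [← smul_sub, hy]
  congr 1
  simp only [Matrix.add_mulVec, Matrix.smul_mulVec, Matrix.vecMulVec_mulVec, WithLp.ofLp_sub,
    Matrix.mulVec_sub]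
  ext k
  simp
  ring

end Algebra

/-! ### Powers of the weight matrix and scalar diffusion recursions -/

namespace Network

variable {n : ℕ} (G : Network n)

lemma weight_pow_nonneg (k : ℕ) (i j : Fin n) : 0 ≤ (G.weight ^ k) i j := by
  induction k generalizing i j with
  | zero => rw [pow_zero, Matrix.one_apply]; split_ifs <;> norm_num
  | succ k ih =>
    rw [pow_succ, Matrix.mul_apply]
    exact Finset.sum_nonneg fun l _ => mul_nonneg (ih i l) (G.nonneg l j)

lemma weight_pow_row_sum (k : ℕ) (i : Fin n) : ∑ j, (G.weight ^ k) i j = 1 := by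
  induction k generalizing i with
  | zero => simp [Matrix.one_apply]
  | succ k ih =>
    simp only [pow_succ, Matrix.mul_apply]
    rw [Finset.sum_comm]
    simp only [← Finset.mul_sum, G.row_sum, mul_one, ih]

/-- Walks shorter than k are padded by staying at the endpoint, which the positive self-weights
allow. -/
lemma weight_pow_pos_of_walk {i j : Fin n} (w : G.graph.Walk i j) (k : ℕ) (hk : w.length ≤ k) :
    0 < (G.weight ^ k) i j := by
  have step : ∀ (k : ℕ) (i l j : Fin n), 0 < G.weight i l → 0 < (G.weight ^ k) l j →
      0 < (G.weight ^ (k + 1)) i j := by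
    intro k i l j h1 h2
    rw [pow_succ', Matrix.mul_apply]
    exact Finset.sum_pos' (fun a _ => mul_nonneg (G.nonneg i a) (G.weight_pow_nonneg k a j))
      ⟨l, Finset.mem_univ l, mul_pos h1 h2⟩
  induction k generalizing i with
  | zero =>
    cases w with
    | nil => simp
    | cons h w => simp at hk
  | succ k ih =>
    cases w with
    | nil => exact step k _ _ _ (G.self_pos _) (ih .nil (by simp))
    | cons h w => exact step k i _ j h.2 (ih w (by simpa using hk))

lemma weight_pow_diameter_pos (hG : G.graph.Connected) (i j : Fin n) :
    0 < (G.weight ^ G.diameter) i j := by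
  have := hG.nonempty
  obtain ⟨w, hw⟩ := hG.exists_walk_length_eq_dist i j
  exact G.weight_pow_pos_of_walk w _
    (hw.le.trans (SimpleGraph.dist_le_diam (SimpleGraph.connected_iff_ediam_ne_top.1 hG)))

lemma aMin_pos (hG : G.graph.Connected) : 0 < G.aMin := by
  have := hG.nonempty
  obtain ⟨ij, hij⟩ := exists_eq_ciInf_of_finite
    (f := fun ij : Fin n × Fin n => (G.weight ^ G.diameter) ij.1 ij.2)
  rw [aMin, ← hij]
  exact G.weight_pow_diameter_pos hG _ _

lemma aMin_le_weight_pow_diameter (i j : Fin n) : G.aMin ≤ (G.weight ^ G.diameter) i j :=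
  ciInf_le (f := fun ij : Fin n × Fin n => (G.weight ^ G.diameter) ij.1 ij.2)
    (Set.finite_range _).bddBelow (i, j)

/-- Higher powers average the entries of the power at the diameter, with the rows of a stochastic
matrix as weights. -/
lemma aMin_le_weight_pow {k : ℕ} (hk : G.diameter ≤ k) (i j : Fin n) :
    G.aMin ≤ (G.weight ^ k) i j := by
  obtain ⟨l, rfl⟩ := Nat.exists_eq_add_of_le' hk
  rw [pow_add, Matrix.mul_apply]
  calc G.aMin = ∑ a, (G.weight ^ l) i a * G.aMin := by
        rw [← Finset.sum_mul, G.weight_pow_row_sum, one_mul]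
    _ ≤ _ := Finset.sum_le_sum fun a _ => mul_le_mul_of_nonneg_left
        (G.aMin_le_weight_pow_diameter a j) (G.weight_pow_nonneg l i a)

lemma weight_pow_le_one (k : ℕ) (i j : Fin n) : (G.weight ^ k) i j ≤ 1 := by
  rw [← G.weight_pow_row_sum k i]
  exact Finset.single_le_sum (fun a _ => G.weight_pow_nonneg k i a) (Finset.mem_univ j)

lemma aMin_le_one (hG : G.graph.Connected) : G.aMin ≤ 1 := by
  obtain ⟨i⟩ := hG.nonempty
  exact (G.aMin_le_weight_pow_diameter i i).trans (G.weight_pow_le_one _ i i)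

lemma weight_le_one (i j : Fin n) : G.weight i j ≤ 1 := by
  simpa using G.weight_pow_le_one 1 i j

/-- The solution of the forgetting-factor diffusion recursion. -/
lemma diffusion_eq {α : ℝ} {Q f : ℕ → Fin n → ℝ}
    (hQ : ∀ t i, Q (t + 1) i = ∑ j, G.weight i j * (α * Q t j + f t j)) (t : ℕ) :
    Q t = α ^ t • (G.weight ^ t *ᵥ Q 0) +
      ∑ s ∈ Finset.range t, α ^ (t - 1 - s) • (G.weight ^ (t - s) *ᵥ f s) := by
  induction t with
  | zero => simp
  | succ t ih =>
    have h1 : Q (t + 1) = G.weight *ᵥ (α • Q t + f t) := by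
      ext i
      simp [hQ, Matrix.mulVec, dotProduct]
    rw [h1, ih, Finset.sum_range_succ, Matrix.mulVec_add, smul_add, Matrix.mulVec_add,
      ← add_assoc]
    congr 1
    · congr 1
      · rw [Matrix.mulVec_smul, Matrix.mulVec_smul, Matrix.mulVec_mulVec, smul_smul, pow_succ',
          pow_succ']
      · rw [Finset.smul_sum, Matrix.mulVec_sum]
        refine Finset.sum_congr rfl fun s hs => ?_
        have hs := Finset.mem_range.1 hs
        rw [Matrix.mulVec_smul, Matrix.mulVec_smul, Matrix.mulVec_mulVec, smul_smul,
          ← pow_succ', ← pow_succ']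
        congr 3 <;> omega
    · simp

/-- In the closed form, the source at time s reaches every sensor with weight at least `aMin` once t
- s is at least the diameter. All other terms are nonnegative and are dropped. -/
lemma diffusion_lower {α : ℝ} (hα : 0 < α) {Q f : ℕ → Fin n → ℝ}
    (hQ : ∀ t i, Q (t + 1) i = ∑ j, G.weight i j * (α * Q t j + f t j))
    (hQ0 : ∀ i, 0 ≤ Q 0 i) (hf : ∀ t i, 0 ≤ f t i) (t : ℕ) (S : Finset ℕ)
    (hS : ∀ s ∈ S, s + G.diameter + 1 ≤ t) (i : Fin n) :
    G.aMin * ∑ s ∈ S, α ^ (t - 1 - s) * ∑ j, f s j ≤ Q t i := by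
  rw [G.diffusion_eq hQ]
  simp only [Pi.add_apply, Pi.smul_apply, Finset.sum_apply, smul_eq_mul, Matrix.mulVec, dotProduct]
  have h0 : 0 ≤ α ^ t * ∑ j, (G.weight ^ t) i j * Q 0 j :=
    mul_nonneg (by positivity) (Finset.sum_nonneg fun j _ =>
      mul_nonneg (G.weight_pow_nonneg _ _ _) (hQ0 j))
  have h1 : S ⊆ Finset.range t := fun s hs => Finset.mem_range.2 (by have := hS s hs; omega)
  have h2 : ∑ s ∈ S, α ^ (t - 1 - s) * ∑ j, (G.weight ^ (t - s)) i j * f s j ≤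
      ∑ s ∈ Finset.range t, α ^ (t - 1 - s) * ∑ j, (G.weight ^ (t - s)) i j * f s j :=
    Finset.sum_le_sum_of_subset_of_nonneg h1 fun s _ _ =>
      mul_nonneg (by positivity) (Finset.sum_nonneg fun j _ =>
        mul_nonneg (G.weight_pow_nonneg _ _ _) (hf s j))
  have h3 : G.aMin * ∑ s ∈ S, α ^ (t - 1 - s) * ∑ j, f s j ≤
      ∑ s ∈ S, α ^ (t - 1 - s) * ∑ j, (G.weight ^ (t - s)) i j * f s j := by
    rw [Finset.mul_sum]
    refine Finset.sum_le_sum fun s hs => ?_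
    rw [mul_left_comm, Finset.mul_sum]
    refine mul_le_mul_of_nonneg_left (Finset.sum_le_sum fun j _ => ?_) (by positivity)
    exact mul_le_mul_of_nonneg_right (G.aMin_le_weight_pow (by have := hS s hs; omega) i j) (hf s j)
  linarith

lemma diffusion_initial_lower {α c : ℝ} (hα : 0 < α) {Q f : ℕ → Fin n → ℝ}
    (hQ : ∀ t i, Q (t + 1) i = ∑ j, G.weight i j * (α * Q t j + f t j))
    (hQ0 : ∀ i, c ≤ Q 0 i) (hf : ∀ t i, 0 ≤ f t i) (t : ℕ) (i : Fin n) :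
    α ^ t * c ≤ Q t i := by
  induction t generalizing i with
  | zero => simpa using hQ0 i
  | succ t ih =>
    rw [hQ]
    calc α ^ (t + 1) * c = ∑ j, G.weight i j * (α ^ (t + 1) * c) := by
          rw [← Finset.sum_mul, G.row_sum, one_mul]
      _ ≤ _ := by
          refine Finset.sum_le_sum fun j _ => mul_le_mul_of_nonneg_left ?_ (G.nonneg i j)
          have := mul_le_mul_of_nonneg_left (ih j) hα.le
          have := hf t j
          rw [pow_succ']; linarith

end Network

/-! ### Quadratic forms of the information matrices and of the blocks -/

section Quadratic

variable {n m : ℕ}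

lemma dotProduct_vecMulVec_mulVec (v u : Fin m → ℝ) :
    u ⬝ᵥ Matrix.vecMulVec v v *ᵥ u = (v ⬝ᵥ u) ^ 2 := by
  rw [Matrix.vecMulVec_mulVec, op_smul_eq_smul, dotProduct_smul, smul_eq_mul, dotProduct_comm u v]
  ring

lemma dotProduct_sq_le (v u : Vec m) : (v.ofLp ⬝ᵥ u.ofLp) ^ 2 ≤ ‖v‖ ^ 2 * ‖u‖ ^ 2 := by
  have h := abs_real_inner_le_norm v u
  rw [EuclideanSpace.inner_eq_star_dotProduct, star_trivial, dotProduct_comm] at h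
  rw [← mul_pow, ← sq_abs]
  gcongr

lemma dotProduct_self_eq (u : Vec m) : u.ofLp ⬝ᵥ u.ofLp = ‖u‖ ^ 2 := by
  rw [EuclideanSpace.real_norm_sq_eq]
  simp [dotProduct, sq]

lemma infoMat_quad_succ (G : Network n) {α : ℝ} {P₀ : Fin n → Matrix (Fin m) (Fin m) ℝ}
    (hα : 0 < α) (hP₀ : ∀ i, (P₀ i).PosDef) (φ : ℕ → Fin n → Vec m) (u : Fin m → ℝ) (t : ℕ)
    (i : Fin n) :
    u ⬝ᵥ infoMat G α P₀ φ (t + 1) i *ᵥ u = ∑ j, G.weight i j *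
      (α * (u ⬝ᵥ infoMat G α P₀ φ t j *ᵥ u) + ((φ t j).ofLp ⬝ᵥ u) ^ 2) := by
  rw [infoMat_succ G hα hP₀, Matrix.sum_mulVec, dotProduct_sum]
  refine Finset.sum_congr rfl fun j _ => ?_
  rw [Matrix.smul_mulVec, dotProduct_smul, Matrix.add_mulVec, dotProduct_add, Matrix.smul_mulVec,
    dotProduct_smul, dotProduct_vecMulVec_mulVec, smul_eq_mul, smul_eq_mul]

variable {Ω : Type*}

lemma blockInfo_quad (h : ℕ) (φ : ℕ → Fin n → Ω → Vec m) (k : ℕ) (ω : Ω) (u : Fin m → ℝ) :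
    u ⬝ᵥ blockInfo h φ k ω *ᵥ u = ((n : ℝ) * (1 + (h : ℝ)))⁻¹ *
      ∑ i, ∑ s ∈ Finset.Icc (k * h + 1) ((k + 1) * h),
        (1 + ‖φ s i ω‖ ^ 2)⁻¹ * ((φ s i ω).ofLp ⬝ᵥ u) ^ 2 := by
  simp only [blockInfo, Matrix.smul_mulVec, Matrix.sum_mulVec, dotProduct_smul, dotProduct_sum,
    smul_eq_mul, dotProduct_vecMulVec_mulVec]

lemma blockInfo_quad_nonneg (h : ℕ) (φ : ℕ → Fin n → Ω → Vec m) (k : ℕ) (ω : Ω)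
    (u : Fin m → ℝ) : 0 ≤ u ⬝ᵥ blockInfo h φ k ω *ᵥ u := by
  rw [blockInfo_quad]
  positivity

/-- There are n h normalized terms against the factor n(1 + h). The gap between h/(1 + h) and 1
later keeps the excitation level away from 1. -/
lemma blockInfo_quad_le (h : ℕ) (φ : ℕ → Fin n → Ω → Vec m) (k : ℕ) (ω : Ω) (u : Vec m) :
    u.ofLp ⬝ᵥ blockInfo h φ k ω *ᵥ u.ofLp ≤ h / (1 + h) * ‖u‖ ^ 2 := by
  rw [blockInfo_quad]
  have h1 : ∑ i, ∑ s ∈ Finset.Icc (k * h + 1) ((k + 1) * h),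
      (1 + ‖φ s i ω‖ ^ 2)⁻¹ * ((φ s i ω).ofLp ⬝ᵥ u.ofLp) ^ 2 ≤
      ∑ i : Fin n, ∑ s ∈ Finset.Icc (k * h + 1) ((k + 1) * h), ‖u‖ ^ 2 := by
    refine Finset.sum_le_sum fun i _ => Finset.sum_le_sum fun s _ => ?_
    rw [inv_mul_le_iff₀ (by positivity)]
    nlinarith [dotProduct_sq_le (φ s i ω) u, sq_nonneg ‖u‖]
  refine (mul_le_mul_of_nonneg_left h1 (by positivity)).trans ?_
  simp only [Finset.sum_const, Nat.card_Icc, Finset.card_univ, Fintype.card_fin, nsmul_eq_mul]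
  have h2 : (k + 1) * h + 1 - (k * h + 1) = h := by rw [add_mul]; omega
  rw [h2]
  rcases Nat.eq_zero_or_pos n with rfl | hn
  · simp; positivity
  · have : (0 : ℝ) < n := by exact_mod_cast hn
    apply le_of_eq
    field_simp

lemma blockInfo_quad_le_sum (h : ℕ) (φ : ℕ → Fin n → Ω → Vec m) (k : ℕ) (ω : Ω)
    (u : Fin m → ℝ) : u ⬝ᵥ blockInfo h φ k ω *ᵥ u ≤
      ∑ s ∈ Finset.Ioc (k * h) ((k + 1) * h), ∑ i, ((φ s i ω).ofLp ⬝ᵥ u) ^ 2 := by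
  rw [blockInfo_quad, Finset.sum_comm]
  have hI : Finset.Icc (k * h + 1) ((k + 1) * h) = Finset.Ioc (k * h) ((k + 1) * h) := by
    ext; simp
  rw [hI]
  have h1 : ∑ s ∈ Finset.Ioc (k * h) ((k + 1) * h), ∑ i,
      (1 + ‖φ s i ω‖ ^ 2)⁻¹ * ((φ s i ω).ofLp ⬝ᵥ u) ^ 2 ≤
      ∑ s ∈ Finset.Ioc (k * h) ((k + 1) * h), ∑ i, ((φ s i ω).ofLp ⬝ᵥ u) ^ 2 := by
    refine Finset.sum_le_sum fun s _ => Finset.sum_le_sum fun i _ => ?_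
    refine mul_le_of_le_one_left (sq_nonneg _) (inv_le_one_of_one_le₀ ?_)
    nlinarith [sq_nonneg ‖φ s i ω‖]
  refine le_trans ?_ h1
  refine mul_le_of_le_one_left (by positivity) ?_
  rcases Nat.eq_zero_or_pos n with rfl | hn
  · simp
  · refine inv_le_one_of_one_le₀ ?_
    have : (1 : ℝ) ≤ n := by exact_mod_cast hn
    nlinarith [Nat.cast_nonneg (α := ℝ) h]

lemma sum_blocks (h : ℕ) (f : ℕ → ℝ) {k T : ℕ} (hkT : k ≤ T) :
    ∑ j ∈ Finset.Icc (k + 1) T, ∑ s ∈ Finset.Ioc (j * h) ((j + 1) * h), f s =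
      ∑ s ∈ Finset.Ioc ((k + 1) * h) ((T + 1) * h), f s := by
  induction T, hkT using Nat.le_induction with
  | base => simp
  | succ T hT ih =>
    rw [Finset.sum_Icc_succ_top (by omega), ih, Finset.sum_Ioc_consecutive]
    · exact Nat.mul_le_mul_right _ (by omega)
    · exact Nat.mul_le_mul_right _ (by omega)

/-- The lower bound on t lets block T reach all sensors; the upper bound limits how much of the last
r blocks has been forgotten. -/
lemma infoMat_quad_lower (G : Network n) {α : ℝ} {P₀ : Fin n → Matrix (Fin m) (Fin m) ℝ}
    (hα : 0 < α) (hα1 : α < 1) (hP₀ : ∀ i, (P₀ i).PosDef) (hG : G.graph.Connected)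
    (φ : ℕ → Fin n → Ω → Vec m) (h : ℕ) (ω : Ω)
    (u : Fin m → ℝ) {t T r : ℕ} (hr : r ≤ T) (ht : (T + 1) * h + G.diameter + 1 ≤ t)
    (ht' : t ≤ (T + 2) * h + G.diameter + 1) (i : Fin n) :
    G.aMin * α ^ (h + G.diameter) * (α ^ h) ^ r *
      ∑ j ∈ Finset.Icc (T - r + 1) T, u ⬝ᵥ blockInfo h φ j ω *ᵥ u ≤
    u ⬝ᵥ infoMat G α P₀ (fun s j => φ s j ω) t i *ᵥ u := by
  have ha := G.aMin_pos hG
  set S := Finset.Ioc ((T - r + 1) * h) ((T + 1) * h)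
  refine le_trans ?_ (G.diffusion_lower hα
    (Q := fun t i => u ⬝ᵥ infoMat G α P₀ (fun s j => φ s j ω) t i *ᵥ u)
    (f := fun t j => ((φ t j ω).ofLp ⬝ᵥ u) ^ 2)
    (fun t i => infoMat_quad_succ G hα hP₀ _ u t i)
    (fun i => by
      have := (infoMat_posDef G hα hP₀ (fun s j => φ s j ω) 0 i).posSemidef.dotProduct_mulVec_nonneg u
      simpa using this)
    (fun t j => sq_nonneg _) t S (fun s hs => ?_) i)
  · rw [mul_assoc, mul_assoc]
    refine mul_le_mul_of_nonneg_left ?_ ha.le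
    have h1 : ∑ j ∈ Finset.Icc (T - r + 1) T, u ⬝ᵥ blockInfo h φ j ω *ᵥ u ≤
        ∑ s ∈ S, ∑ i, ((φ s i ω).ofLp ⬝ᵥ u) ^ 2 := by
      rw [← sum_blocks h _ (by omega : T - r ≤ T)]
      exact Finset.sum_le_sum fun j _ => blockInfo_quad_le_sum h φ j ω u
    rw [← mul_assoc, ← pow_mul, ← pow_add]
    refine (mul_le_mul_of_nonneg_left h1 (by positivity)).trans ?_
    rw [Finset.mul_sum]
    refine Finset.sum_le_sum fun s hs => mul_le_mul_of_nonneg_right ?_ (by positivity)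
    refine pow_le_pow_of_le_one hα.le hα1.le ?_
    have hs1 := (Finset.mem_Ioc.1 hs).1
    obtain ⟨k, rfl⟩ := Nat.exists_eq_add_of_le' hr
    simp only [Nat.add_sub_cancel] at hs1
    -- The oldest datum in the window has exponent t - 1 - s below h + h r plus the diameter.
    have : (k + r + 2) * h = (k + 1) * h + (h + h * r) := by ring
    omega
  · have := (Finset.mem_Ioc.1 hs).2
    omega

/-- Only the initial matrices are used, through the minimum of their forms on the unit sphere. This
deterministic bound is the fallback when no window is exciting. -/
lemma infoMat_quad_initial_lower (G : Network n) {α : ℝ}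
    {P₀ : Fin n → Matrix (Fin m) (Fin m) ℝ} (hα : 0 < α) (hP₀ : ∀ i, (P₀ i).PosDef) :
    ∃ c : ℝ, 0 < c ∧ ∀ (φ : ℕ → Fin n → Vec m) (t : ℕ) (i : Fin n) (u : Vec m),
      α ^ t * (c * ‖u‖ ^ 2) ≤ u.ofLp ⬝ᵥ infoMat G α P₀ φ t i *ᵥ u.ofLp := by
  have h1 : ∀ i, ∃ c : ℝ, 0 < c ∧ ∀ u : Vec m,
      c * ‖u‖ ^ 2 ≤ u.ofLp ⬝ᵥ (P₀ i)⁻¹ *ᵥ u.ofLp := by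
    intro i
    have hR := (hP₀ i).inv
    set R := (P₀ i)⁻¹
    rcases Nat.eq_zero_or_pos m with rfl | hm
    · exact ⟨1, one_pos, fun u => by simp [Subsingleton.elim u 0]⟩
    have : Nonempty (Fin m) := ⟨⟨0, hm⟩⟩
    have hne : (Metric.sphere (0 : Vec m) 1).Nonempty := by
      have : Nontrivial (Vec m) := by
        refine ⟨⟨EuclideanSpace.single ⟨0, hm⟩ 1, 0, fun he => ?_⟩⟩
        simpa using congrArg norm he
      exact NormedSpace.sphere_nonempty.2 zero_le_one
    have hc : Continuous fun u : Vec m => u.ofLp ⬝ᵥ R *ᵥ u.ofLp := by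
      simp only [dotProduct, Matrix.mulVec]
      fun_prop
    obtain ⟨v, hv, hmin⟩ := (isCompact_sphere (0 : Vec m) 1).exists_isMinOn hne hc.continuousOn
    have hv1 : ‖v‖ = 1 := by simpa using hv
    refine ⟨v.ofLp ⬝ᵥ R *ᵥ v.ofLp, ?_, fun u => ?_⟩
    · have hv0 : v.ofLp ≠ 0 := fun he => by
        have : v = 0 := by ext k; simpa using congrFun he k
        simp [this] at hv1
      simpa using hR.dotProduct_mulVec_pos hv0
    · rcases eq_or_ne u 0 with rfl | hu
      · simp
      have hu' : 0 < ‖u‖ := norm_pos_iff.2 hu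
      have := isMinOn_iff.1 hmin (‖u‖⁻¹ • u) (by simp [norm_smul, hu'.ne'])
      rw [WithLp.ofLp_smul, Matrix.mulVec_smul, smul_dotProduct, dotProduct_smul, smul_eq_mul,
        smul_eq_mul] at this
      calc v.ofLp ⬝ᵥ R *ᵥ v.ofLp * ‖u‖ ^ 2 ≤
          ‖u‖⁻¹ * (‖u‖⁻¹ * u.ofLp ⬝ᵥ R *ᵥ u.ofLp) * ‖u‖ ^ 2 := by gcongr
        _ = _ := by field_simp
  choose c hc hcu using h1
  -- A positive number below every `c i`, written without choosing a minimizing sensor.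
  refine ⟨(∑ i, (c i)⁻¹ + 1)⁻¹, ?_, fun φ t i u => ?_⟩
  · have : 0 ≤ ∑ i, (c i)⁻¹ := Finset.sum_nonneg fun i _ => (inv_pos.2 (hc i)).le
    positivity
  refine G.diffusion_initial_lower hα
    (Q := fun t i => u.ofLp ⬝ᵥ infoMat G α P₀ φ t i *ᵥ u.ofLp)
    (f := fun t j => ((φ t j).ofLp ⬝ᵥ u.ofLp) ^ 2)
    (fun t i => infoMat_quad_succ G hα hP₀ _ _ t i) (fun i => ?_) (fun t j => sq_nonneg _) t i
  refine le_trans (mul_le_mul_of_nonneg_right ?_ (sq_nonneg _)) (hcu i u)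
  rw [inv_le_comm₀ _ (hc i)]
  · have := Finset.single_le_sum (f := fun i => (c i)⁻¹) (fun j _ => (inv_pos.2 (hc j)).le)
      (Finset.mem_univ i)
    linarith
  · have : 0 ≤ ∑ i, (c i)⁻¹ := Finset.sum_nonneg fun i _ => (inv_pos.2 (hc i)).le
    positivity

/-- If `uᵀ R u ≥ κ |u|²` then `κ |u| ≤ |R u|`. -/
lemma norm_le_of_quad_lower {R : Matrix (Fin m) (Fin m) ℝ} {κ : ℝ} {u : Vec m}
    (hq : κ * ‖u‖ ^ 2 ≤ u.ofLp ⬝ᵥ R *ᵥ u.ofLp) :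
    κ * ‖u‖ ≤ ‖(WithLp.toLp 2 (R *ᵥ u.ofLp) : Vec m)‖ := by
  have h1 := dotProduct_sq_le u (WithLp.toLp 2 (R *ᵥ u.ofLp))
  rcases eq_or_ne u 0 with rfl | hu
  · simp
  have hu' : 0 < ‖u‖ := norm_pos_iff.2 hu
  have h2 : u.ofLp ⬝ᵥ R *ᵥ u.ofLp ≤ ‖u‖ * ‖(WithLp.toLp 2 (R *ᵥ u.ofLp) : Vec m)‖ := by
    rw [← mul_pow] at h1
    exact le_of_sq_le_sq h1 (by positivity)
  refine le_of_mul_le_mul_left ?_ hu'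
  linarith

end Quadratic

/-! ### Scalar majorants of the information matrices and transformed errors -/

section ScalarBounds

variable {n m : ℕ}

/-- The solution of the scalar recursion `x (t + 1) = α x t + d t`. -/
def forget (α x₀ : ℝ) (d : ℕ → ℝ) : ℕ → ℝ
  | 0 => x₀
  | t + 1 => α * forget α x₀ d t + d t

lemma forget_nonneg {α x₀ : ℝ} {d : ℕ → ℝ} (hα : 0 ≤ α) (hx : 0 ≤ x₀) (hd : ∀ t, 0 ≤ d t)
    (t : ℕ) : 0 ≤ forget α x₀ d t := by
  induction t with
  | zero => exact hx
  | succ t ih => exact add_nonneg (mul_nonneg hα ih) (hd t)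

/-- The common bound `a` is averaged, so no factor n multiplies the part that is iterated; in the
source terms the weights are merely bounded by 1. -/
lemma Network.norm_sum_weight_le {E : Type*} [NormedAddCommGroup E] [NormedSpace ℝ E]
    (G : Network n) (i : Fin n) (x y : Fin n → E) {a : ℝ} {b : Fin n → ℝ}
    (hx : ∀ j, ‖x j‖ ≤ a) (hy : ∀ j, ‖y j‖ ≤ b j) :
    ‖∑ j, G.weight i j • (x j + y j)‖ ≤ a + ∑ j, b j := by
  refine (norm_sum_le _ _).trans ?_
  calc ∑ j, ‖G.weight i j • (x j + y j)‖ ≤ ∑ j, (G.weight i j * a + b j) := by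
        refine Finset.sum_le_sum fun j _ => ?_
        rw [norm_smul, Real.norm_of_nonneg (G.nonneg i j)]
        have h1 := mul_le_mul_of_nonneg_left ((norm_add_le (x j) (y j)).trans
          (add_le_add (hx j) (hy j))) (G.nonneg i j)
        have h2 : G.weight i j * b j ≤ b j :=
          mul_le_of_le_one_left ((norm_nonneg _).trans (hy j)) (G.weight_le_one i j)
        linarith
    _ = _ := by rw [Finset.sum_add_distrib, ← Finset.sum_mul, G.row_sum, one_mul]

variable (G : Network n) {α : ℝ} {P₀ : Fin n → Matrix (Fin m) (Fin m) ℝ}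

lemma infoMat_norm_le (hα : 0 < α) (hP₀ : ∀ i, (P₀ i).PosDef) :
    ∃ ρ₀ : ℝ, 0 ≤ ρ₀ ∧ ∀ (φ : ℕ → Fin n → Vec m) (t : ℕ) (i : Fin n) (v : Vec m),
      ‖(WithLp.toLp 2 (infoMat G α P₀ φ t i *ᵥ v.ofLp) : Vec m)‖ ≤
        forget α ρ₀ (fun s => ∑ j, ‖φ s j‖ ^ 2) t * ‖v‖ := by
  refine ⟨∑ i, ‖Matrix.toEuclideanCLM (𝕜 := ℝ) (P₀ i)⁻¹‖,
    Finset.sum_nonneg fun i _ => norm_nonneg _, fun φ t i v => ?_⟩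
  induction t generalizing i with
  | zero =>
    have h1 := (Matrix.toEuclideanCLM (𝕜 := ℝ) (P₀ i)⁻¹).le_opNorm v
    refine le_trans h1 (mul_le_mul_of_nonneg_right ?_ (norm_nonneg _))
    exact Finset.single_le_sum (f := fun i => ‖Matrix.toEuclideanCLM (𝕜 := ℝ) (P₀ i)⁻¹‖)
      (fun i _ => norm_nonneg _) (Finset.mem_univ i)
  | succ t ih =>
    have h1 : (WithLp.toLp 2 (infoMat G α P₀ φ (t + 1) i *ᵥ v.ofLp) : Vec m) =
        ∑ j, G.weight i j • (α • (WithLp.toLp 2 (infoMat G α P₀ φ t j *ᵥ v.ofLp) : Vec m) +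
          ((φ t j).ofLp ⬝ᵥ v.ofLp) • φ t j) := by
      rw [infoMat_succ G hα hP₀, Matrix.sum_mulVec]
      ext k
      simp only [WithLp.ofLp_sum, Finset.sum_apply, Matrix.smul_mulVec,
        Matrix.add_mulVec, Matrix.vecMulVec_mulVec, op_smul_eq_smul]
      simp [mul_add]
    rw [h1, forget, add_mul, Finset.sum_mul]
    refine G.norm_sum_weight_le i _ _ (fun j => ?_) fun j => ?_
    · rw [norm_smul, Real.norm_of_nonneg hα.le, mul_assoc]
      exact mul_le_mul_of_nonneg_left (ih j) hα.le
    · rw [norm_smul, sq, mul_assoc, mul_comm]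
      refine mul_le_mul_of_nonneg_left ?_ (norm_nonneg _)
      refine abs_le_of_sq_le_sq ?_ (by positivity)
      rw [mul_pow]
      exact dotProduct_sq_le _ _

/-- The bound of the transformed tracking error by the initial error and the disturbances. -/
lemma infoMat_error_le (hα : 0 < α) (hP₀ : ∀ i, (P₀ i).PosDef) (φ : ℕ → Fin n → Vec m)
    (θ₀ : Fin n → Vec m) (y w : ℕ → Fin n → ℝ) (θ : ℕ → Vec m)
    (hy : ∀ t i, y (t + 1) i = (φ t i).ofLp ⬝ᵥ (θ t).ofLp + w (t + 1) i) {ρ : ℕ → ℝ}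
    (hρ : ∀ (t : ℕ) (i : Fin n) (v : Vec m),
      ‖(WithLp.toLp 2 (infoMat G α P₀ φ t i *ᵥ v.ofLp) : Vec m)‖ ≤ ρ t * ‖v‖)
    (t : ℕ) (i : Fin n) :
    ‖(WithLp.toLp 2 (infoMat G α P₀ φ t i *ᵥ
        (θ t - estimate G α P₀ θ₀ φ y t i).ofLp) : Vec m)‖ ≤
      α ^ t * ∑ j, ρ 0 * ‖θ 0 - θ₀ j‖ +
      forget α 0 (fun s => ρ (s + 1) * ‖θ (s + 1) - θ s‖ + ∑ j, ‖φ s j‖ * |w (s + 1) j|) t := by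
  induction t generalizing i with
  | zero =>
    rw [forget, pow_zero, one_mul, add_zero]
    refine (hρ 0 i _).trans ?_
    exact Finset.single_le_sum (f := fun j => ρ 0 * ‖θ 0 - θ₀ j‖)
      (fun j _ => (norm_nonneg _).trans (hρ 0 j (θ 0 - θ₀ j))) (Finset.mem_univ i)
  | succ t ih =>
    have h1 : (WithLp.toLp 2 (infoMat G α P₀ φ (t + 1) i *ᵥ
        (θ (t + 1) - estimate G α P₀ θ₀ φ y (t + 1) i).ofLp) : Vec m) =
        WithLp.toLp 2 (infoMat G α P₀ φ (t + 1) i *ᵥ (θ (t + 1) - θ t).ofLp) +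
        ∑ j, G.weight i j • (α • (WithLp.toLp 2 (infoMat G α P₀ φ t j *ᵥ
          (θ t - estimate G α P₀ θ₀ φ y t j).ofLp) : Vec m) + (-w (t + 1) j) • φ t j) := by
      rw [infoMat_mulVec_error_succ G hα hP₀ φ θ₀ y w θ hy]
      ext k
      simp [sub_eq_add_neg]
    rw [h1]
    refine (norm_add_le _ _).trans ?_
    have h2 := hρ (t + 1) i (θ (t + 1) - θ t)
    have h3 := G.norm_sum_weight_le i (fun j => α • (WithLp.toLp 2 (infoMat G α P₀ φ t j *ᵥ
      (θ t - estimate G α P₀ θ₀ φ y t j).ofLp) : Vec m)) (fun j => (-w (t + 1) j) • φ t j)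
      (b := fun j => ‖φ t j‖ * |w (t + 1) j|)
      (fun j => by
        rw [norm_smul, Real.norm_of_nonneg hα.le]
        exact mul_le_mul_of_nonneg_left (ih j) hα.le)
      (fun j => by rw [norm_smul, norm_neg, Real.norm_eq_abs, mul_comm])
    refine (add_le_add h2 h3).trans (le_of_eq ?_)
    rw [forget, pow_succ]
    ring

lemma norm_stack_le (v : Fin n → Vec m) : ‖stack v‖ ≤ ∑ i, ‖v i‖ := by
  have h1 : ‖stack v‖ ^ 2 = ∑ i, ‖v i‖ ^ 2 := by
    simp only [EuclideanSpace.real_norm_sq_eq, stack, Fintype.sum_prod_type]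
  refine le_of_sq_le_sq ?_ (Finset.sum_nonneg fun i _ => norm_nonneg _)
  rw [h1]
  exact Finset.sum_sq_le_sq_sum_of_nonneg fun i _ => norm_nonneg _

end ScalarBounds

/-! ### The variational form of the smallest eigenvalue -/

section LambdaMin

variable {m : ℕ}

/-- Both sides say that X - c is positive semidefinite. In dimension zero the spectrum is empty and
`sInf` takes the value 0, hence `0 < m`. -/
lemma le_lambdaMin_iff (hm : 0 < m) {X : Matrix (Fin m) (Fin m) ℝ} (hX : X.IsHermitian) (c : ℝ) :
    c ≤ lambdaMin X ↔ ∀ u : Fin m → ℝ, c * (u ⬝ᵥ u) ≤ u ⬝ᵥ X *ᵥ u := by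
  have : Nonempty (Fin m) := ⟨⟨0, hm⟩⟩
  have hs := hX.spectrum_real_eq_range_eigenvalues
  have hfin : (spectrum ℝ X).Finite := by rw [hs]; exact Set.finite_range _
  have hne : (spectrum ℝ X).Nonempty := by rw [hs]; exact Set.range_nonempty _
  have hXc : (X - c • (1 : Matrix (Fin m) (Fin m) ℝ)).IsHermitian :=
    hX.sub (by simp [Matrix.IsHermitian])
  have hquad : ∀ u : Fin m → ℝ, star u ⬝ᵥ (X - c • (1 : Matrix (Fin m) (Fin m) ℝ)) *ᵥ u =
      u ⬝ᵥ X *ᵥ u - c * (u ⬝ᵥ u) := by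
    intro u
    simp [Matrix.sub_mulVec, Matrix.smul_mulVec, dotProduct_sub, dotProduct_smul]
  have hspec : ∀ x : ℝ, x ∈ spectrum ℝ (X - c • (1 : Matrix (Fin m) (Fin m) ℝ)) ↔
      x + c ∈ spectrum ℝ X := by
    intro x
    rw [← Algebra.algebraMap_eq_smul_one, ← spectrum.sub_singleton_eq]
    simp
    constructor
    · rintro ⟨y, hy, rfl⟩; simpa using hy
    · intro hx; exact ⟨x + c, hx, by simp⟩
  constructor
  · intro hc u
    have hpsd : (X - c • (1 : Matrix (Fin m) (Fin m) ℝ)).PosSemidef := by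
      rw [hXc.posSemidef_iff_eigenvalues_nonneg]
      intro i
      have := (hspec _).1 (hXc.eigenvalues_mem_spectrum_real i)
      have := csInf_le hfin.bddBelow this
      simp only [Pi.zero_apply]
      rw [lambdaMin] at hc
      linarith
    have := hpsd.dotProduct_mulVec_nonneg u
    rw [hquad] at this
    linarith
  · intro hu
    refine le_csInf hne fun x hx => ?_
    rw [hs] at hx
    obtain ⟨i, rfl⟩ := hx
    have h1 := hX.mulVec_eigenvectorBasis i
    have h2 := hu (hX.eigenvectorBasis i).ofLp
    rw [h1, dotProduct_smul, smul_eq_mul, dotProduct_self_eq, hX.eigenvectorBasis.norm_eq_one] at h2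
    linarith

end LambdaMin

/-! ### An exponential supermartingale and the tail of small sums -/

section SmallSums

variable {Ω : Type*}

/-- The likelihood-type process `∏ exp (-x j) / (1 - l j / 2)`. -/
def expRatio (x l : ℕ → Ω → ℝ) (k T : ℕ) (ω : Ω) : ℝ :=
  ∏ j ∈ Finset.Icc (k + 1) T, Real.exp (-x j ω) * (1 - l j ω / 2)⁻¹

/-- The factor 1/2 buys a bound that is affine in x, so that it can be compared with a conditional
mean. -/
lemma exp_neg_le_one_sub_half {x : ℝ} (h0 : 0 ≤ x) (h1 : x ≤ 1) :
    Real.exp (-x) ≤ 1 - x / 2 := by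
  have h2 : Real.exp (-x) ≤ 1 / (1 + x + x ^ 2 / 2) := by
    rw [Real.exp_neg, one_div]
    exact inv_anti₀ (by positivity) (Real.quadratic_le_exp_of_nonneg h0)
  refine h2.trans ?_
  rw [div_le_iff₀ (by positivity)]
  nlinarith [mul_nonneg h0 (sub_nonneg.2 h1), mul_nonneg h0 (mul_nonneg h0 (sub_nonneg.2 h1)),
    mul_nonneg h0 (sq_nonneg x)]

lemma expRatio_succ (x l : ℕ → Ω → ℝ) {k T : ℕ} (hkT : k ≤ T) (ω : Ω) :
    expRatio x l k (T + 1) ω =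
      expRatio x l k T ω * (1 - l (T + 1) ω / 2)⁻¹ * Real.exp (-x (T + 1) ω) := by
  rw [expRatio, Finset.prod_Icc_succ_top (by omega), ← expRatio]
  ring

lemma half_inv_bounds {l : ℝ} (h : l ∈ Set.Icc (0 : ℝ) 1) :
    0 ≤ (1 - l / 2)⁻¹ ∧ (1 - l / 2)⁻¹ ≤ 2 := by
  have h2 : (0 : ℝ) < 1 - l / 2 := by linarith [h.2]
  refine ⟨(inv_pos.2 h2).le, ?_⟩
  rw [inv_le_comm₀ h2 two_pos]
  linarith [h.2]

lemma expRatio_nonneg {x l : ℕ → Ω → ℝ} (hl : ∀ j ω, l j ω ∈ Set.Icc (0 : ℝ) 1) (k T : ℕ) (ω : Ω) :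
    0 ≤ expRatio x l k T ω :=
  Finset.prod_nonneg fun j _ => mul_nonneg (Real.exp_pos _).le (half_inv_bounds (hl j ω)).1

lemma expRatio_le {x l : ℕ → Ω → ℝ} (hx : ∀ j ω, x j ω ∈ Set.Icc (0 : ℝ) 1)
    (hl : ∀ j ω, l j ω ∈ Set.Icc (0 : ℝ) 1) (k T : ℕ) (ω : Ω) :
    expRatio x l k T ω ≤ 2 ^ (Finset.Icc (k + 1) T).card := by
  rw [expRatio]
  rw [← Finset.prod_const]
  refine Finset.prod_le_prod
    (fun j _ => mul_nonneg (Real.exp_pos _).le (half_inv_bounds (hl j ω)).1) fun j _ => ?_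
  have h1 : Real.exp (-x j ω) ≤ 1 := Real.exp_le_one_iff.2 (by linarith [(hx j ω).1])
  have h2 := half_inv_bounds (hl j ω)
  calc _ ≤ 1 * (2 : ℝ) := mul_le_mul h1 h2.2 h2.1 zero_le_one
    _ = 2 := one_mul _

variable [mΩ : MeasurableSpace Ω] {μ : Measure Ω} [IsProbabilityMeasure μ]

lemma measurable_expRatio {𝓖 : Filtration ℕ mΩ} {x l : ℕ → Ω → ℝ}
    (hxm : ∀ j, Measurable[𝓖 (j + 1)] (x j)) (hlm : ∀ j, Measurable[𝓖 j] (l j)) (k T : ℕ) :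
    Measurable[𝓖 (T + 1)] (expRatio x l k T) := by
  have hs : expRatio x l k T = fun ω => ∏ j ∈ Finset.Icc (k + 1) T,
    Real.exp (-x j ω) * (1 - l j ω / 2)⁻¹ := rfl
  rw [hs]
  refine Finset.measurable_prod _ fun j hj => ?_
  have hj := (Finset.mem_Icc.1 hj).2
  have h1 : Measurable[𝓖 (T + 1)] (x j) := (hxm j).mono (𝓖.mono (by omega)) le_rfl
  have h2 : Measurable[𝓖 (T + 1)] (l j) := (hlm j).mono (𝓖.mono (by omega)) le_rfl
  exact (Real.measurable_exp.comp h1.neg).mul ((measurable_const.sub (h2.div_const 2)).inv)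

lemma integrable_of_bounds {f : Ω → ℝ} (hf : Measurable f) {C : ℝ} (h0 : ∀ ω, 0 ≤ f ω)
    (hC : ∀ ω, f ω ≤ C) : Integrable f μ :=
  Integrable.of_bound hf.aestronglyMeasurable C
    (ae_of_all _ fun ω => by rw [Real.norm_of_nonneg (h0 ω)]; exact hC ω)

variable {𝓖 : Filtration ℕ mΩ} {x l : ℕ → Ω → ℝ}

/-- The supermartingale property: `hxl` is the tested form of E(x_j | 𝓖_j) ≥ l_j, whence E(exp(-x_j)
| 𝓖_j) ≤ 1 - l_j/2, and the inverse factor in `expRatio` compensates exactly this. -/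
lemma integral_expRatio_le (hxm : ∀ j, Measurable[𝓖 (j + 1)] (x j))
    (hlm : ∀ j, Measurable[𝓖 j] (l j)) (hx : ∀ j ω, x j ω ∈ Set.Icc (0 : ℝ) 1)
    (hl : ∀ j ω, l j ω ∈ Set.Icc (0 : ℝ) 1)
    (hxl : ∀ j (g : Ω → ℝ) (C : ℝ), Measurable[𝓖 j] g → (∀ ω, 0 ≤ g ω) → (∀ ω, g ω ≤ C) →
      ∫ ω, g ω * l j ω ∂μ ≤ ∫ ω, g ω * x j ω ∂μ) {k T : ℕ} (hkT : k ≤ T) :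
    ∫ ω, expRatio x l k T ω ∂μ ≤ 1 := by
  induction T, hkT using Nat.le_induction with
  | base => simp [expRatio]
  | succ T hT ih =>
    refine le_trans ?_ ih
    set C : ℝ := 2 ^ (Finset.Icc (k + 1) T).card with hC
    have hC0 : 0 ≤ C := by positivity
    set g : Ω → ℝ := fun ω => expRatio x l k T ω * (1 - l (T + 1) ω / 2)⁻¹ with hg
    have hgm : Measurable[𝓖 (T + 1)] g :=
      (measurable_expRatio hxm hlm k T).mul
        ((measurable_const.sub ((hlm (T + 1)).div_const 2)).inv)
    have hgm' : Measurable g := hgm.mono (𝓖.le _) le_rfl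
    have hg0 : ∀ ω, 0 ≤ g ω := fun ω =>
      mul_nonneg (expRatio_nonneg hl k T ω) (half_inv_bounds (hl _ ω)).1
    have hgC : ∀ ω, g ω ≤ C * 2 := fun ω =>
      mul_le_mul (expRatio_le hx hl k T ω) (half_inv_bounds (hl _ ω)).2
        (half_inv_bounds (hl _ ω)).1 hC0
    have hxm' : Measurable (x (T + 1)) := (hxm _).mono (𝓖.le _) le_rfl
    have hlm' : Measurable (l (T + 1)) := (hlm _).mono (𝓖.le _) le_rfl
    have hgi : Integrable g μ := integrable_of_bounds hgm' hg0 hgC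
    have hprod : ∀ f : Ω → ℝ, Measurable f → (∀ ω, f ω ∈ Set.Icc (0 : ℝ) 1) →
        Integrable (fun ω => g ω * f ω) μ := fun f hf hf1 =>
      integrable_of_bounds (hgm'.mul hf) (fun ω => mul_nonneg (hg0 ω) (hf1 ω).1) (C := C * 2)
        fun ω => (mul_le_of_le_one_right (hg0 ω) (hf1 ω).2).trans (hgC ω)
    have hgx := hprod _ hxm' (hx _)
    have hgl := hprod _ hlm' (hl _)
    have hsub : ∀ f : Ω → ℝ, Integrable (fun ω => g ω * f ω) μ →
        ∫ ω, g ω * (1 - f ω / 2) ∂μ = ∫ ω, g ω ∂μ - (∫ ω, g ω * f ω ∂μ) / 2 := by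
      intro f hf
      rw [← integral_div, ← integral_sub hgi (hf.div_const 2)]
      congr 1
      ext ω
      ring
    calc ∫ ω, expRatio x l k (T + 1) ω ∂μ = ∫ ω, g ω * Real.exp (-x (T + 1) ω) ∂μ := by
          simp only [expRatio_succ x l hT, hg]
      _ ≤ ∫ ω, g ω * (1 - x (T + 1) ω / 2) ∂μ := by
          refine integral_mono (hprod _ (Real.measurable_exp.comp hxm'.neg) fun ω => ?_)
            (hprod _ (measurable_const.sub (hxm'.div_const 2)) fun ω => ?_) fun ω => ?_
          · exact ⟨(Real.exp_pos _).le, Real.exp_le_one_iff.2 (by linarith [(hx (T + 1) ω).1])⟩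
          · exact ⟨by linarith [(hx (T + 1) ω).2], by linarith [(hx (T + 1) ω).1]⟩
          · exact mul_le_mul_of_nonneg_left
              (exp_neg_le_one_sub_half (hx _ ω).1 (hx _ ω).2) (hg0 ω)
      _ ≤ ∫ ω, g ω * (1 - l (T + 1) ω / 2) ∂μ := by
          rw [hsub _ hgx, hsub _ hgl]
          have := hxl (T + 1) g (C * 2) hgm hg0 hgC
          linarith
      _ = ∫ ω, expRatio x l k T ω ∂μ := by
          congr 1
          ext ω
          have : (0 : ℝ) < 1 - l (T + 1) ω / 2 := by linarith [(hl (T + 1) ω).2]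
          rw [hg, mul_assoc, inv_mul_cancel₀ this.ne', mul_one]

/-- A tail estimate for sums of conditionally excited variables. -/
lemma measure_small_sum_le (hxm : ∀ j, Measurable[𝓖 (j + 1)] (x j))
    (hlm : ∀ j, Measurable[𝓖 j] (l j)) (hx : ∀ j ω, x j ω ∈ Set.Icc (0 : ℝ) 1)
    (hl : ∀ j ω, l j ω ∈ Set.Icc (0 : ℝ) 1)
    (hxl : ∀ j (g : Ω → ℝ) (C : ℝ), Measurable[𝓖 j] g → (∀ ω, 0 ≤ g ω) → (∀ ω, g ω ≤ C) →
      ∫ ω, g ω * l j ω ∂μ ≤ ∫ ω, g ω * x j ω ∂μ) {N : ℕ}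
    (hN : ∀ j ω, (1 - l j ω / 2) ^ N ≤ 1 - l j ω) {ρ M : ℝ} (hρ : 0 < ρ) {k T : ℕ} (hkT : k ≤ T)
    (hM : ∫ ω, ∏ j ∈ Finset.Icc (k + 1) T, (1 - l j ω) ∂μ ≤ M * (ρ ^ (N + 1)) ^ (T - k)) :
    μ.real {ω | ∑ j ∈ Finset.Icc (k + 1) T, x j ω < 1} ≤
      (Real.exp 1 + M) * ρ ^ (T - k) := by
  set B := {ω | ∑ j ∈ Finset.Icc (k + 1) T, x j ω < 1}
  set δ := ρ ^ (T - k)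
  have hδ : 0 < δ := by positivity
  have hxm' : ∀ j, Measurable (x j) := fun j => (hxm j).mono (𝓖.le _) le_rfl
  have hlm' : ∀ j, Measurable (l j) := fun j => (hlm j).mono (𝓖.le _) le_rfl
  have hB : MeasurableSet B :=
    measurableSet_lt (Finset.measurable_sum _ fun j _ => hxm' j) measurable_const
  set p : Ω → ℝ := fun ω => ∏ j ∈ Finset.Icc (k + 1) T, (1 - l j ω)
  have hp0 : ∀ ω, 0 ≤ p ω := fun ω => Finset.prod_nonneg fun j _ => by linarith [(hl j ω).2]
  have hpi : Integrable p μ := by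
    refine integrable_of_bounds (C := 1) (Finset.measurable_prod _ fun j _ =>
      measurable_const.sub (hlm' j)) hp0 fun ω => ?_
    exact Finset.prod_le_one (fun j _ => by linarith [(hl j ω).2])
      fun j _ => by linarith [(hl j ω).1]
  have hHi : Integrable (expRatio x l k T) μ :=
    integrable_of_bounds ((measurable_expRatio hxm hlm k T).mono (𝓖.le _) le_rfl)
      (expRatio_nonneg hl k T) (expRatio_le hx hl k T)
  -- Let d be the product of the 1 - l_j/2. If d < δ, the small sum forces the ratio above e⁻¹/δ; if
  -- d ≥ δ, then `hN` gives p ≥ d^N ≥ δ^N. Each summand covers one case.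
  have key : ∀ ω, B.indicator (fun _ => (1 : ℝ)) ω ≤
      Real.exp 1 * δ * expRatio x l k T ω + (δ ^ N)⁻¹ * p ω := by
    intro ω
    have hH0 := expRatio_nonneg (x := x) hl k T ω
    by_cases hω : ω ∈ B
    · rw [Set.indicator_of_mem hω]
      set d := ∏ j ∈ Finset.Icc (k + 1) T, (1 - l j ω / 2) with hd
      have hd0 : 0 < d := Finset.prod_pos fun j _ => by linarith [(hl j ω).2]
      have hHd : expRatio x l k T ω = Real.exp (-∑ j ∈ Finset.Icc (k + 1) T, x j ω) * d⁻¹ := by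
        rw [expRatio, Finset.prod_mul_distrib, ← Real.exp_sum, Finset.sum_neg_distrib, hd,
          Finset.prod_inv_distrib]
      rcases lt_or_ge d δ with h1 | h1
      · have h2 : Real.exp (-1) * δ⁻¹ ≤ expRatio x l k T ω := by
          rw [hHd]
          refine mul_le_mul ?_ (inv_anti₀ hd0 h1.le) (by positivity) (Real.exp_pos _).le
          exact Real.exp_le_exp.2 (neg_le_neg (le_of_lt hω))
        have h3 : Real.exp 1 * δ * (Real.exp (-1) * δ⁻¹) = 1 := by
          rw [Real.exp_neg]
          field_simp
        have h4 := mul_le_mul_of_nonneg_left h2 (by positivity : 0 ≤ Real.exp 1 * δ)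
        have h5 : 0 ≤ (δ ^ N)⁻¹ * p ω := mul_nonneg (by positivity) (hp0 ω)
        linarith
      · have h2 : δ ^ N ≤ p ω := by
          refine (pow_le_pow_left₀ hδ.le h1 N).trans ?_
          rw [hd, ← Finset.prod_pow]
          exact Finset.prod_le_prod (fun j _ => pow_nonneg (by linarith [(hl j ω).2]) _)
            fun j _ => hN j ω
        have h3 : 1 ≤ (δ ^ N)⁻¹ * p ω := by
          rw [inv_mul_eq_div, one_le_div (by positivity)]
          exact h2
        have h4 : 0 ≤ Real.exp 1 * δ * expRatio x l k T ω := mul_nonneg (by positivity) hH0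
        linarith
    · rw [Set.indicator_of_notMem hω]
      exact add_nonneg (mul_nonneg (by positivity) hH0) (mul_nonneg (by positivity) (hp0 ω))
  have h1 : μ.real B = ∫ ω, B.indicator (fun _ => (1 : ℝ)) ω ∂μ := by
    rw [integral_indicator_const _ hB]; simp
  rw [h1]
  refine (integral_mono ((integrable_const 1).indicator hB)
    ((hHi.const_mul _).add (hpi.const_mul _)) key).trans ?_
  simp only [Pi.add_apply]
  rw [integral_add (hHi.const_mul _) (hpi.const_mul _), integral_const_mul, integral_const_mul]
  have h2 := integral_expRatio_le hxm hlm hx hl hxl hkT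
  -- Of the N + 1 powers of ρ in the excitation rate, N cancel δ^{-N} and one remains as the decay.
  have h3 : (δ ^ N)⁻¹ * (M * (ρ ^ (N + 1)) ^ (T - k)) = M * δ := by
    have : (ρ ^ (N + 1)) ^ (T - k) = δ ^ N * δ := by
      simp only [δ]
      rw [← pow_succ, ← pow_mul, ← pow_mul, mul_comm]
    rw [this]
    field_simp
  have h4 := mul_le_mul_of_nonneg_left hM (by positivity : 0 ≤ (δ ^ N)⁻¹)
  have h5 := mul_le_mul_of_nonneg_left h2 (by positivity : 0 ≤ Real.exp 1 * δ)
  rw [h3] at h4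
  calc _ ≤ Real.exp 1 * δ * 1 + M * δ := add_le_add h5 h4
    _ = _ := by ring

end SmallSums

/-! ### Entries of the block matrices and measurability of the smallest eigenvalue -/

section BlockInfo

variable {n m : ℕ} {Ω : Type*}

lemma blockInfo_apply (h : ℕ) (φ : ℕ → Fin n → Ω → Vec m) (k : ℕ) (ω : Ω) (a b : Fin m) :
    blockInfo h φ k ω a b = ((n : ℝ) * (1 + (h : ℝ)))⁻¹ *
      ∑ i, ∑ s ∈ Finset.Icc (k * h + 1) ((k + 1) * h),
        (1 + ‖φ s i ω‖ ^ 2)⁻¹ * (φ s i ω a * φ s i ω b) := by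
  simp [blockInfo, Matrix.sum_apply, Matrix.vecMulVec_apply]

lemma abs_blockInfo_le (h : ℕ) (φ : ℕ → Fin n → Ω → Vec m) (k : ℕ) (ω : Ω) (a b : Fin m) :
    |blockInfo h φ k ω a b| ≤ ((n : ℝ) * (1 + (h : ℝ)))⁻¹ *
      ∑ _i : Fin n, ∑ _s ∈ Finset.Icc (k * h + 1) ((k + 1) * h), 1 := by
  rw [blockInfo_apply, abs_mul, abs_of_nonneg (by positivity)]
  refine mul_le_mul_of_nonneg_left ?_ (by positivity)
  refine (Finset.abs_sum_le_sum_abs _ _).trans (Finset.sum_le_sum fun i _ => ?_)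
  refine (Finset.abs_sum_le_sum_abs _ _).trans (Finset.sum_le_sum fun s _ => ?_)
  rw [abs_mul, abs_of_nonneg (by positivity), inv_mul_le_iff₀ (by positivity), mul_one, abs_mul]
  have ha := PiLp.norm_apply_le (φ s i ω) a
  have hb := PiLp.norm_apply_le (φ s i ω) b
  rw [Real.norm_eq_abs] at ha hb
  have := mul_le_mul ha hb (abs_nonneg _) (norm_nonneg _)
  nlinarith

/-- The smallest eigenvalue is a measurable function of a symmetric matrix. -/
lemma measurable_lambdaMin [mΩ' : MeasurableSpace Ω] (hm : 0 < m)
    {X : Ω → Matrix (Fin m) (Fin m) ℝ} (hX : ∀ ω, (X ω).IsHermitian)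
    (hmeas : ∀ a b, Measurable fun ω => X ω a b) : Measurable fun ω => lambdaMin (X ω) := by
  refine measurable_of_Ici fun c => ?_
  -- The intersection over all u is uncountable, but closed and therefore measurable.
  set C : Set (Fin m → Fin m → ℝ) :=
    {f | ∀ u : Fin m → ℝ, c * (u ⬝ᵥ u) ≤ ∑ a, u a * ∑ b, f a b * u b}
  have hC : IsClosed C := by
    simp only [C, Set.ofPred_forall]
    refine isClosed_iInter fun u => isClosed_le continuous_const ?_
    fun_prop
  have hmeas' : Measurable fun ω (a b : Fin m) => X ω a b :=
    measurable_pi_lambda _ fun a => measurable_pi_lambda _ fun b => hmeas a b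
  have : (fun ω => lambdaMin (X ω)) ⁻¹' Set.Ici c = (fun ω (a b : Fin m) => X ω a b) ⁻¹' C := by
    ext ω
    rw [Set.mem_preimage, Set.mem_Ici, le_lambdaMin_iff hm (hX ω)]
    rfl
  rw [this]
  exact hmeas' hC.measurableSet

end BlockInfo

/-! ### Conditional excitation and the tail bound in a fixed direction -/

section Excitation

variable {n m : ℕ} {Ω : Type*} [mΩ : MeasurableSpace Ω] {μ : Measure Ω}
  {𝓕 : Filtration ℕ mΩ} {h : ℕ} {φ : ℕ → Fin n → Ω → Vec m}

/-- The filtration at the block boundaries. -/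
def blockFiltration (𝓕 : Filtration ℕ mΩ) (h : ℕ) : Filtration ℕ mΩ where
  seq k := 𝓕 (k * h)
  mono' _ _ hij := 𝓕.mono (Nat.mul_le_mul_right h hij)
  le' _ := 𝓕.le _

lemma measurable_blockInfo (hφ : ∀ i, StronglyAdapted 𝓕 fun t => φ t i) (k : ℕ) (a b : Fin m) :
    Measurable[𝓕 ((k + 1) * h)] fun ω => blockInfo h φ k ω a b := by
  simp only [blockInfo_apply]
  refine measurable_const.mul (Finset.measurable_sum _ fun i _ => Finset.measurable_sum _
    fun s hs => ?_)
  have h1 : StronglyMeasurable[𝓕 ((k + 1) * h)] (φ s i) :=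
    (hφ i s).mono (𝓕.mono (Finset.mem_Icc.1 hs).2)
  have h2 : ∀ a, Measurable[𝓕 ((k + 1) * h)] fun ω => φ s i ω a := fun a =>
    ((EuclideanSpace.proj (𝕜 := ℝ) a).continuous.measurable).comp h1.measurable
  exact (measurable_const.add (h1.norm.measurable.pow_const 2)).inv.mul ((h2 a).mul (h2 b))

lemma integrable_blockInfo [IsProbabilityMeasure μ] (hφ : ∀ i, StronglyAdapted 𝓕 fun t => φ t i) (k : ℕ) (a b : Fin m) :
    Integrable (fun ω => blockInfo h φ k ω a b) μ :=
  Integrable.of_bound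
    ((measurable_blockInfo hφ k a b).mono (𝓕.le _) le_rfl).aestronglyMeasurable _
    (ae_of_all _ fun ω => abs_blockInfo_le h φ k ω a b)

lemma condExpMat_isHermitian (k : ℕ) (ω : Ω) :
    (condExpMat μ (𝓕 (k * h)) (blockInfo h φ k) ω).IsHermitian := by
  ext a b
  have : (fun ω => blockInfo h φ k ω b a) = fun ω => blockInfo h φ k ω a b := by
    ext ω
    simp only [blockInfo_apply, mul_comm (φ _ _ ω a)]
  simp [condExpMat, this]

lemma measurable_excitation (hm : 0 < m) (k : ℕ) :
    Measurable[𝓕 (k * h)] (excitation μ 𝓕 h φ k) :=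
  measurable_lambdaMin (mΩ' := 𝓕 (k * h)) hm (condExpMat_isHermitian k)
    fun _ _ => stronglyMeasurable_condExp.measurable

/-- The excitation level, clipped to its essential range. -/
def clippedExcitation (μ : Measure Ω) (𝓕 : Filtration ℕ mΩ) (h : ℕ)
    (φ : ℕ → Fin n → Ω → Vec m) (k : ℕ) (ω : Ω) : ℝ :=
  max 0 (min (h / (1 + h)) (excitation μ 𝓕 h φ k ω))

lemma clippedExcitation_nonneg (k : ℕ) (ω : Ω) : 0 ≤ clippedExcitation μ 𝓕 h φ k ω :=
  le_max_left _ _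

lemma clippedExcitation_le (k : ℕ) (ω : Ω) :
    clippedExcitation μ 𝓕 h φ k ω ≤ h / (1 + h) :=
  max_le (by positivity) (min_le_left _ _)

lemma clippedExcitation_mem (k : ℕ) (ω : Ω) :
    clippedExcitation μ 𝓕 h φ k ω ∈ Set.Icc (0 : ℝ) 1 :=
  ⟨clippedExcitation_nonneg k ω, (clippedExcitation_le k ω).trans
    ((div_le_one (by positivity)).2 (by linarith))⟩

lemma measurable_clippedExcitation (hm : 0 < m) (k : ℕ) :
    Measurable[𝓕 (k * h)] (clippedExcitation μ 𝓕 h φ k) :=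
  measurable_const.max (measurable_const.min (measurable_excitation hm k))

/-- Bernoulli gives (1 + x/2)^{4h} ≥ 1 + 2hx, hence (1 - x/2)^{4h} ≤ 1/(1 + 2hx). This is at most 1
- x because 2h(1 - x) ≥ 1 for x ≤ h/(1 + h) and h ≥ 1. -/
lemma one_sub_half_clipped_pow_le (hh : 0 < h) (k : ℕ) (ω : Ω) :
    (1 - clippedExcitation μ 𝓕 h φ k ω / 2) ^ (4 * h) ≤ 1 - clippedExcitation μ 𝓕 h φ k ω := by
  set x := clippedExcitation μ 𝓕 h φ k ω
  have hx0 : 0 ≤ x := clippedExcitation_nonneg k ω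
  have hx1 : x ≤ h / (1 + h) := clippedExcitation_le k ω
  have hh' : (1 : ℝ) ≤ h := by exact_mod_cast hh
  have hxh : x * (1 + h) ≤ h := (le_div_iff₀ (by positivity)).1 hx1
  have hx2 : x < 1 := lt_of_le_of_lt hx1 ((div_lt_one (by positivity)).2 (by linarith))
  have hy : 0 ≤ 1 - x / 2 := by linarith
  have hB : 1 + ((4 * h : ℕ) : ℝ) * (x / 2) ≤ (1 + x / 2) ^ (4 * h) :=
    one_add_mul_le_pow (by linarith) _
  have hprod : (1 - x / 2) ^ (4 * h) * (1 + x / 2) ^ (4 * h) ≤ 1 := by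
    rw [← mul_pow]
    exact pow_le_one₀ (mul_nonneg hy (by linarith)) (by nlinarith)
  have hP : 0 ≤ (1 - x / 2) ^ (4 * h) := pow_nonneg hy _
  have h1 : (1 - x / 2) ^ (4 * h) * (1 + 2 * h * x) ≤ 1 := by
    refine le_trans (mul_le_mul_of_nonneg_left ?_ hP) hprod
    refine le_trans (le_of_eq ?_) hB
    push_cast
    ring
  have h2 : 1 ≤ (1 - x) * (1 + 2 * h * x) := by
    have : 0 ≤ x * (2 * h * (1 - x) - 1) := by
      refine mul_nonneg hx0 ?_
      nlinarith
    nlinarith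
  have h3 : 0 < 1 + 2 * h * x := by positivity
  exact le_of_mul_le_mul_right (h1.trans h2) h3

variable [IsProbabilityMeasure μ]

/-- The conditional expectation is taken entrywise, so the form is expanded into entries and `g` is
pulled out of each. -/
lemma integral_mul_quad (hφ : ∀ i, StronglyAdapted 𝓕 fun t => φ t i) (k : ℕ) {g : Ω → ℝ} {C : ℝ}
    (hg : Measurable[𝓕 (k * h)] g) (hgC : ∀ ω, |g ω| ≤ C) (u : Fin m → ℝ) :
    Integrable (fun ω => g ω * (u ⬝ᵥ condExpMat μ (𝓕 (k * h)) (blockInfo h φ k) ω *ᵥ u)) μ ∧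
    ∫ ω, g ω * (u ⬝ᵥ condExpMat μ (𝓕 (k * h)) (blockInfo h φ k) ω *ᵥ u) ∂μ =
      ∫ ω, g ω * (u ⬝ᵥ blockInfo h φ k ω *ᵥ u) ∂μ := by
  have hexp : ∀ X : Matrix (Fin m) (Fin m) ℝ, ∀ r : ℝ,
      r * (u ⬝ᵥ X *ᵥ u) = ∑ a, ∑ b, u a * u b * (r * X a b) := by
    intro X r
    simp only [dotProduct, Matrix.mulVec, Finset.mul_sum]
    exact Finset.sum_congr rfl fun a _ => Finset.sum_congr rfl fun b _ => by ring
  have hg' : AEStronglyMeasurable g μ := (hg.mono (𝓕.le _) le_rfl).aestronglyMeasurable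
  have hb : ∀ f : Ω → ℝ, Integrable f μ → Integrable (fun ω => g ω * f ω) μ := fun f hf =>
    hf.bdd_mul hg' (ae_of_all _ hgC)
  have h1 : ∀ a b, Integrable (fun ω => g ω * blockInfo h φ k ω a b) μ := fun a b =>
    hb _ (integrable_blockInfo hφ k a b)
  have h2 : ∀ a b, Integrable
      (fun ω => g ω * condExpMat μ (𝓕 (k * h)) (blockInfo h φ k) ω a b) μ := fun a b =>
    hb _ integrable_condExp
  have h3 : ∀ a b, ∫ ω, g ω * condExpMat μ (𝓕 (k * h)) (blockInfo h φ k) ω a b ∂μ =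
      ∫ ω, g ω * blockInfo h φ k ω a b ∂μ := by
    intro a b
    have hpull := condExp_mul_of_stronglyMeasurable_left (μ := μ) (m := 𝓕 (k * h))
      (f := g) (g := fun ω => blockInfo h φ k ω a b) hg.stronglyMeasurable (h1 a b)
      (integrable_blockInfo hφ k a b)
    calc _ = ∫ ω, (μ[g * fun ω => blockInfo h φ k ω a b | 𝓕 (k * h)]) ω ∂μ :=
          (integral_congr_ae hpull).symm
      _ = _ := integral_condExp (𝓕.le _)
  simp only [hexp]
  refine ⟨integrable_finsetSum _ fun a _ => integrable_finsetSum _ fun b _ =>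
    (h2 a b).const_mul _, ?_⟩
  rw [integral_finsetSum _ fun a _ => integrable_finsetSum _ fun b _ => (h2 a b).const_mul _,
    integral_finsetSum _ fun a _ => integrable_finsetSum _ fun b _ => (h1 a b).const_mul _]
  refine Finset.sum_congr rfl fun a _ => ?_
  rw [integral_finsetSum _ fun b _ => (h2 a b).const_mul _,
    integral_finsetSum _ fun b _ => (h1 a b).const_mul _]
  refine Finset.sum_congr rfl fun b _ => ?_
  rw [integral_const_mul, integral_const_mul, h3]

/-- The smallest eigenvalue is at most a diagonal entry, and the diagonal entries of the block
matrix are at most h/(1 + h). -/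
lemma excitation_le (hm : 0 < m) (hφ : ∀ i, StronglyAdapted 𝓕 fun t => φ t i) (k : ℕ) :
    ∀ᵐ ω ∂μ, excitation μ 𝓕 h φ k ω ≤ h / (1 + h) := by
  set a : Fin m := ⟨0, hm⟩
  have h1 : (μ[fun ω => blockInfo h φ k ω a a | 𝓕 (k * h)]) ≤ᵐ[μ]
      μ[fun _ => (h : ℝ) / (1 + h) | 𝓕 (k * h)] := by
    refine condExp_mono (integrable_blockInfo hφ k a a) (integrable_const _)
      (ae_of_all _ fun ω => ?_)
    have := blockInfo_quad_le h φ k ω (EuclideanSpace.single a 1)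
    simpa using this
  rw [condExp_const (𝓕.le _)] at h1
  filter_upwards [h1] with ω hω
  have h2 := (le_lambdaMin_iff hm (condExpMat_isHermitian (μ := μ) (𝓕 := 𝓕) (h := h) (φ := φ) k ω)
    (excitation μ 𝓕 h φ k ω)).1 le_rfl (Pi.single a 1)
  simp only [single_one_dotProduct, Pi.single_eq_same, mul_one, Matrix.mulVec_single_one] at h2
  exact h2.trans hω

/-- The tail estimate asks for bounds at every ω, while the excitation obeys them only almost
surely; clipping changes it on a null set. -/
lemma clippedExcitation_ae_eq (hm : 0 < m) {lam : ℝ}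
    (hexc : CooperativeExcitation μ 𝓕 h lam φ) (k : ℕ) :
    clippedExcitation μ 𝓕 h φ k =ᵐ[μ] excitation μ 𝓕 h φ k := by
  filter_upwards [excitation_le hm hexc.1 k, hexc.2.2.1 k] with ω h1 h2
  rw [clippedExcitation, min_eq_right h1, max_eq_right]
  linarith [h2.2]

/-- The probability that a fixed direction is poorly excited over a window of blocks. -/
lemma measure_direction_le (hm : 0 < m) (hh : 0 < h) {ρ : ℝ} (hρ : 0 < ρ)
    (hexc : CooperativeExcitation μ 𝓕 h (ρ ^ (4 * h + 1)) φ) :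
    ∃ M : ℝ, 0 < M ∧ ∀ (v : Vec m), v ≠ 0 → ∀ k T : ℕ, k ≤ T →
      μ.real {ω | ∑ j ∈ Finset.Icc (k + 1) T, v.ofLp ⬝ᵥ blockInfo h φ j ω *ᵥ v.ofLp < ‖v‖ ^ 2} ≤
        (Real.exp 1 + M) * ρ ^ (T - k) := by
  obtain ⟨M, hM0, hM⟩ := hexc.2.2.2
  refine ⟨M, hM0, fun v hv k T hkT => ?_⟩
  have hv' : 0 < ‖v‖ ^ 2 := by have := norm_pos_iff.2 hv; positivity
  set x : ℕ → Ω → ℝ := fun j ω => (v.ofLp ⬝ᵥ blockInfo h φ j ω *ᵥ v.ofLp) / ‖v‖ ^ 2 with hxdef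
  have hset : {ω | ∑ j ∈ Finset.Icc (k + 1) T, v.ofLp ⬝ᵥ blockInfo h φ j ω *ᵥ v.ofLp < ‖v‖ ^ 2} =
      {ω | ∑ j ∈ Finset.Icc (k + 1) T, x j ω < 1} := by
    ext ω
    simp only [Set.mem_ofPred_eq, hxdef]
    rw [← Finset.sum_div, div_lt_one hv']
  rw [hset]
  refine measure_small_sum_le (𝓖 := blockFiltration 𝓕 h) (x := x)
    (l := clippedExcitation μ 𝓕 h φ) (fun j => ?_)
    (fun j => measurable_clippedExcitation hm j) (fun j ω => ?_)
    (fun j ω => clippedExcitation_mem j ω) (fun j g C hg hg0 hgC => ?_)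
    (fun j ω => one_sub_half_clipped_pow_le hh j ω) hρ hkT ?_
  · refine Measurable.div_const ?_ _
    simp only [dotProduct, Matrix.mulVec]
    exact Finset.measurable_sum _ fun a _ => measurable_const.mul
      (Finset.measurable_sum _ fun b _ => (measurable_blockInfo hexc.1 j a b).mul_const _)
  · refine ⟨div_nonneg (blockInfo_quad_nonneg h φ j ω _) hv'.le, (div_le_one hv').2 ?_⟩
    refine (blockInfo_quad_le h φ j ω v).trans (mul_le_of_le_one_left hv'.le ?_)
    exact (div_le_one (by positivity)).2 (by linarith)
  · have hgabs : ∀ ω, |g ω| ≤ C := fun ω => by rw [abs_of_nonneg (hg0 ω)]; exact hgC ω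
    obtain ⟨hi, heq⟩ := integral_mul_quad (μ := μ) hexc.1 j hg hgabs v.ofLp
    simp only [hxdef, ← mul_div_assoc]
    rw [integral_div, ← heq, le_div_iff₀ hv', ← integral_mul_const]
    have hgm : Measurable g := hg.mono (𝓕.le _) le_rfl
    have hcm : Measurable (clippedExcitation μ 𝓕 h φ j) :=
      (measurable_clippedExcitation hm j).mono (𝓕.le _) le_rfl
    refine integral_mono_ae (Integrable.mul_const (integrable_of_bounds (hgm.mul hcm)
      (fun ω => mul_nonneg (hg0 ω) (clippedExcitation_nonneg j ω)) (C := C)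
      fun ω => (mul_le_of_le_one_right (hg0 ω) (clippedExcitation_mem j ω).2).trans (hgC ω)) _)
      hi ?_
    filter_upwards [clippedExcitation_ae_eq hm hexc j] with ω hω
    rw [hω, mul_assoc]
    refine mul_le_mul_of_nonneg_left ?_ (hg0 ω)
    have := (le_lambdaMin_iff hm (condExpMat_isHermitian (μ := μ) (𝓕 := 𝓕) (h := h) (φ := φ) j ω)
      (excitation μ 𝓕 h φ j ω)).1 le_rfl v.ofLp
    rwa [dotProduct_self_eq] at this
  · refine le_trans (le_of_eq (integral_congr_ae ?_)) (hM k T hkT)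
    have : ∀ᵐ ω ∂μ, ∀ j, clippedExcitation μ 𝓕 h φ j ω = excitation μ 𝓕 h φ j ω :=
      ae_all_iff.2 fun j => clippedExcitation_ae_eq hm hexc j
    filter_upwards [this] with ω hω
    simp only [hω]

end Excitation

/-! ### Excitation of all directions through an integer grid -/

section Grid

variable {n m : ℕ} {Ω : Type*}

/-- The vector with the given integer coordinates. -/
def intVec (z : Fin m → ℤ) : Vec m := WithLp.toLp 2 fun a => (z a : ℝ)

/-- The integer vectors with coordinates of absolute value at most `L`. -/
def intGrid (m L : ℕ) : Finset (Fin m → ℤ) := Fintype.piFinset fun _ => Finset.Icc (-L : ℤ) L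

lemma card_intGrid (m L : ℕ) : (intGrid m L).card = (2 * L + 1) ^ m := by
  simp only [intGrid, Fintype.card_piFinset, Int.card_Icc, Finset.prod_const, Finset.card_univ,
    Fintype.card_fin]
  congr 1
  omega

/-- The event that some integer direction is poorly excited over the `r` blocks up to `T`. -/
def poorlyExcited (h : ℕ) (φ : ℕ → Fin n → Ω → Vec m) (T r : ℕ) : Set Ω :=
  ⋃ z ∈ (intGrid m (16 * (r + 1) * m)).filter fun z => intVec z ≠ 0,
    {ω | ∑ j ∈ Finset.Icc (T - r + 1) T,
      (intVec z).ofLp ⬝ᵥ blockInfo h φ j ω *ᵥ (intVec z).ofLp < ‖intVec z‖ ^ 2}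

lemma measurableSet_poorlyExcited [mΩ : MeasurableSpace Ω] {𝓕 : Filtration ℕ mΩ} {h : ℕ}
    {φ : ℕ → Fin n → Ω → Vec m} (hφ : ∀ i, StronglyAdapted 𝓕 fun t => φ t i) (T r : ℕ) :
    MeasurableSet (poorlyExcited h φ T r) := by
  refine Finset.measurableSet_biUnion _ fun z _ => measurableSet_lt ?_ measurable_const
  refine Finset.measurable_sum _ fun j _ => ?_
  simp only [dotProduct, Matrix.mulVec]
  exact Finset.measurable_sum _ fun a _ => measurable_const.mul (Finset.measurable_sum _
    fun b _ => ((measurable_blockInfo hφ j a b).mono (𝓕.le _) le_rfl).mul_const _)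

/-- A union bound: the grid has at most (33 m (r + 1))^m points. That C is at least 1 matters when a
q-th root is taken later. -/
lemma measure_poorlyExcited_le [mΩ : MeasurableSpace Ω] {μ : Measure Ω} [IsProbabilityMeasure μ]
    {𝓕 : Filtration ℕ mΩ} {h : ℕ} {φ : ℕ → Fin n → Ω → Vec m} (hm : 0 < m) (hh : 0 < h) {ρ : ℝ}
    (hρ : 0 < ρ) (hexc : CooperativeExcitation μ 𝓕 h (ρ ^ (4 * h + 1)) φ) :
    ∃ C : ℝ, 1 ≤ C ∧ ∀ T r : ℕ, r ≤ T →
      μ.real (poorlyExcited h φ T r) ≤ C * ((r + 1 : ℝ) ^ m * ρ ^ r) := by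
  obtain ⟨M, hM0, hM⟩ := measure_direction_le hm hh hρ hexc
  have hm1 : (1 : ℝ) ≤ m := by exact_mod_cast hm
  refine ⟨(33 * m) ^ m * (Real.exp 1 + M), ?_, fun T r hr => ?_⟩
  · have h1 : (1 : ℝ) ≤ (33 * m) ^ m := one_le_pow₀ (by linarith)
    have h2 : (1 : ℝ) ≤ Real.exp 1 + M := by linarith [Real.one_le_exp (zero_le_one' ℝ)]
    exact one_le_mul_of_one_le_of_one_le h1 h2
  set S := (intGrid m (16 * (r + 1) * m)).filter fun z => intVec z ≠ 0
  have h1 : μ.real (poorlyExcited h φ T r) ≤ ∑ _z ∈ S, (Real.exp 1 + M) * ρ ^ r := by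
    refine (measureReal_biUnion_finset_le _ _).trans (Finset.sum_le_sum fun z hz => ?_)
    have := hM (intVec z) (Finset.mem_filter.1 hz).2 (T - r) T (by omega)
    rwa [show T - (T - r) = r by omega] at this
  have h2 : (S.card : ℝ) ≤ ((33 * m) * (r + 1 : ℝ)) ^ m := by
    have : (S.card : ℝ) ≤ ((2 * (16 * (r + 1) * m) + 1) ^ m : ℕ) := by
      rw [← card_intGrid]
      exact_mod_cast Finset.card_filter_le _ _
    refine this.trans ?_
    push_cast
    refine pow_le_pow_left₀ (by positivity) ?_ _
    have : (0 : ℝ) ≤ r := Nat.cast_nonneg r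
    nlinarith
  refine h1.trans ?_
  rw [Finset.sum_const, nsmul_eq_mul]
  refine (mul_le_mul_of_nonneg_right h2 (by positivity)).trans (le_of_eq ?_)
  rw [mul_pow]
  ring

lemma quad_add_le {X : Matrix (Fin m) (Fin m) ℝ} (hX : ∀ u, 0 ≤ u ⬝ᵥ X *ᵥ u) (u w : Fin m → ℝ) :
    (u - w) ⬝ᵥ X *ᵥ (u - w) ≤ 2 * (u ⬝ᵥ X *ᵥ u) + 2 * (w ⬝ᵥ X *ᵥ w) := by
  have := hX (u + w)
  simp only [Matrix.mulVec_add, Matrix.mulVec_sub, add_dotProduct, sub_dotProduct, dotProduct_add,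
    dotProduct_sub] at this ⊢
  linarith

/-- Outside the poorly excited event, all directions are excited. -/
lemma quad_lower_of_notMem (hm : 0 < m) {h : ℕ} {φ : ℕ → Fin n → Ω → Vec m} {T r : ℕ}
    (hr : r ≤ T) {ω : Ω} (hω : ω ∉ poorlyExcited h φ T r) (u : Vec m) :
    ‖u‖ ^ 2 / 8 ≤ ∑ j ∈ Finset.Icc (T - r + 1) T, u.ofLp ⬝ᵥ blockInfo h φ j ω *ᵥ u.ofLp := by
  rcases eq_or_ne u 0 with rfl | hu
  · simp
  have hu' : 0 < ‖u‖ := norm_pos_iff.2 hu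
  set L : ℕ := 16 * (r + 1) * m with hL
  have hm1 : (1 : ℝ) ≤ m := by exact_mod_cast hm
  have hr0 : (0 : ℝ) ≤ r := Nat.cast_nonneg r
  have hLr : (L : ℝ) = 16 * (r + 1) * m := by rw [hL]; push_cast; ring
  have hL16 : 16 * (r + 1) * (m : ℝ) ≤ (L : ℝ) ^ 2 := by
    have : (1 : ℝ) ≤ L := by rw [hLr]; nlinarith
    nlinarith
  -- Scale u to length L and round down. The rounding error has squared norm at most m whatever L
  -- is, so over r blocks it costs at most 2 r m, while the grid point has squared norm at least
  -- L²/2 - m. As L² ≥ 16(r + 1)m, these losses leave L²/8.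
  set U : Vec m := ((L : ℝ) / ‖u‖) • u with hU
  have hUn : ‖U‖ = L := by
    rw [hU, norm_smul, Real.norm_of_nonneg (by positivity)]
    field_simp
  set z : Fin m → ℤ := fun a => ⌊U a⌋ with hz
  set w : Vec m := U - intVec z with hw
  have hzw : intVec z = U - w := by simp [hw]
  have hwn : ‖w‖ ^ 2 ≤ m := by
    rw [EuclideanSpace.real_norm_sq_eq]
    calc ∑ a, w a ^ 2 ≤ ∑ _a : Fin m, (1 : ℝ) := by
          refine Finset.sum_le_sum fun a _ => ?_
          have : w a = Int.fract (U a) := rfl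
          rw [this]
          have h1 := Int.fract_nonneg (U a)
          have h2 := (Int.fract_lt_one (U a)).le
          exact pow_le_one₀ h1 h2
      _ = m := by simp
  have hzn : (L : ℝ) ^ 2 / 2 - m ≤ ‖intVec z‖ ^ 2 := by
    have h1 : (L : ℝ) ≤ ‖intVec z‖ + ‖w‖ := by
      rw [← hUn]
      have : U = intVec z + w := by simp [hw]
      calc ‖U‖ = ‖intVec z + w‖ := by rw [← this]
        _ ≤ _ := norm_add_le _ _
    have h2 : (L : ℝ) ^ 2 ≤ (‖intVec z‖ + ‖w‖) ^ 2 := pow_le_pow_left₀ (Nat.cast_nonneg L) h1 2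
    nlinarith [sq_nonneg (‖intVec z‖ - ‖w‖)]
  have hz0 : intVec z ≠ 0 := by
    intro h0
    rw [h0] at hzn
    simp at hzn
    nlinarith
  have hzmem : z ∈ intGrid m L := by
    rw [intGrid, Fintype.mem_piFinset]
    intro a
    have h1 := PiLp.norm_apply_le U a
    rw [hUn, Real.norm_eq_abs, abs_le] at h1
    rw [Finset.mem_Icc]
    refine ⟨Int.le_floor.2 (by push_cast; exact h1.1), ?_⟩
    have h2 : ((z a : ℤ) : ℝ) ≤ L := (Int.floor_le (U a)).trans h1.2
    exact_mod_cast h2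
  have hgood : ‖intVec z‖ ^ 2 ≤ ∑ j ∈ Finset.Icc (T - r + 1) T,
      (intVec z).ofLp ⬝ᵥ blockInfo h φ j ω *ᵥ (intVec z).ofLp := by
    by_contra hcon
    refine hω (Set.mem_biUnion (x := z) ?_ (not_le.1 hcon))
    simpa using ⟨hzmem, hz0⟩
  have hsum : ∑ j ∈ Finset.Icc (T - r + 1) T,
      (intVec z).ofLp ⬝ᵥ blockInfo h φ j ω *ᵥ (intVec z).ofLp ≤
      2 * ∑ j ∈ Finset.Icc (T - r + 1) T, U.ofLp ⬝ᵥ blockInfo h φ j ω *ᵥ U.ofLp + 2 * (r * m) := by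
    have hc : ∑ j ∈ Finset.Icc (T - r + 1) T, (m : ℝ) = r * m := by
      rw [Finset.sum_const, Nat.card_Icc, nsmul_eq_mul]
      congr 2
      omega
    rw [← hc, Finset.mul_sum, Finset.mul_sum, ← Finset.sum_add_distrib]
    refine Finset.sum_le_sum fun j _ => ?_
    rw [hzw, WithLp.ofLp_sub]
    refine (quad_add_le (blockInfo_quad_nonneg h φ j ω) _ _).trans ?_
    have h1 := blockInfo_quad_le h φ j ω w
    have h2 : (h : ℝ) / (1 + h) ≤ 1 := (div_le_one (by positivity)).2 (by linarith)
    have h3 : (h : ℝ) / (1 + h) * ‖w‖ ^ 2 ≤ m :=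
      (mul_le_of_le_one_left (sq_nonneg _) h2).trans hwn
    linarith
  have hUu : ∑ j ∈ Finset.Icc (T - r + 1) T, U.ofLp ⬝ᵥ blockInfo h φ j ω *ᵥ U.ofLp =
      ((L : ℝ) / ‖u‖) ^ 2 *
        ∑ j ∈ Finset.Icc (T - r + 1) T, u.ofLp ⬝ᵥ blockInfo h φ j ω *ᵥ u.ofLp := by
    rw [Finset.mul_sum]
    refine Finset.sum_congr rfl fun j _ => ?_
    rw [hU, WithLp.ofLp_smul, Matrix.mulVec_smul, smul_dotProduct, dotProduct_smul, smul_eq_mul,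
      smul_eq_mul]
    ring
  rw [hUu] at hsum
  set Q := ∑ j ∈ Finset.Icc (T - r + 1) T, u.ofLp ⬝ᵥ blockInfo h φ j ω *ᵥ u.ofLp
  have hLp : 0 < (L : ℝ) ^ 2 := by nlinarith
  have hfin : (L : ℝ) ^ 2 / 8 ≤ ((L : ℝ) / ‖u‖) ^ 2 * Q := by nlinarith
  rw [div_pow, div_mul_eq_mul_div, le_div_iff₀ (by positivity)] at hfin
  refine le_of_mul_le_mul_left ?_ hLp
  linarith

end Grid

/-! ### Hölder's inequality, geometric sums and vanishing sequences in L_p -/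

section LpTools

variable {Ω : Type*} [mΩ : MeasurableSpace Ω] {μ : Measure Ω}

lemma eLpNorm_mul_le_ofReal {a b c : ℝ} (ha : 0 < a) (hb : 0 < b) (hc : 0 < c)
    (habc : a⁻¹ + b⁻¹ = c⁻¹) {f g : Ω → ℝ} (hf : AEStronglyMeasurable f μ)
    (hg : AEStronglyMeasurable g μ) :
    eLpNorm (fun ω => f ω * g ω) (ENNReal.ofReal c) μ ≤
      eLpNorm f (ENNReal.ofReal a) μ * eLpNorm g (ENNReal.ofReal b) μ := by
  have : ENNReal.HolderTriple (ENNReal.ofReal a) (ENNReal.ofReal b) (ENNReal.ofReal c) := by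
    refine ⟨?_⟩
    rw [← ENNReal.ofReal_inv_of_pos ha, ← ENNReal.ofReal_inv_of_pos hb,
      ← ENNReal.ofReal_inv_of_pos hc, ← ENNReal.ofReal_add (by positivity) (by positivity), habc]
  exact eLpNorm_smul_le_mul_eLpNorm (φ := f) (f := g) hg hf

/-- D/(1 - α) is the fixed point of x ↦ αx + D; it closes the induction for bounds uniform in time.
-/
lemma ofReal_mul_inv_one_sub_add {α : ℝ} (hα : 0 ≤ α) (hα1 : α < 1) (D : ℝ≥0∞) :
    ENNReal.ofReal α * (ENNReal.ofReal (1 - α)⁻¹ * D) + D = ENNReal.ofReal (1 - α)⁻¹ * D := by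
  have h0 : 0 < 1 - α := by linarith
  have h1 : ENNReal.ofReal α * ENNReal.ofReal (1 - α)⁻¹ + 1 = ENNReal.ofReal (1 - α)⁻¹ := by
    rw [← ENNReal.ofReal_mul hα, ← ENNReal.ofReal_one, ← ENNReal.ofReal_add (by positivity)
      zero_le_one]
    congr 1
    field_simp
    ring
  calc _ = (ENNReal.ofReal α * ENNReal.ofReal (1 - α)⁻¹ + 1) * D := by ring
    _ = _ := by rw [h1]

lemma measurable_forget {α x₀ : ℝ} {d : ℕ → Ω → ℝ} (hd : ∀ t, Measurable (d t)) (t : ℕ) :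
    Measurable fun ω => forget α x₀ (fun s => d s ω) t := by
  induction t with
  | zero => exact measurable_const
  | succ t ih => exact (ih.const_mul α).add (hd t)

lemma eLpNorm_forget_le [IsProbabilityMeasure μ] {α x₀ : ℝ} (hα : 0 ≤ α) (hα1 : α < 1)
    {d : ℕ → Ω → ℝ} (hd : ∀ t, Measurable (d t)) {q D : ℝ≥0∞} (hq : 1 ≤ q)
    (hD : ∀ t, eLpNorm (d t) q μ ≤ D) (t : ℕ) :
    eLpNorm (fun ω => forget α x₀ (fun s => d s ω) t) q μ ≤
      ‖x₀‖ₑ + ENNReal.ofReal (1 - α)⁻¹ * D := by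
  induction t with
  | zero =>
    simp only [forget]
    rw [eLpNorm_const _ (zero_lt_one.trans_le hq).ne' (IsProbabilityMeasure.ne_zero μ)]
    simp
  | succ t ih =>
    have h1 : (fun ω => forget α x₀ (fun s => d s ω) (t + 1)) =
        α • (fun ω => forget α x₀ (fun s => d s ω) t) + d t := rfl
    rw [h1]
    refine (eLpNorm_add_le ((measurable_forget hd t).const_smul α).aestronglyMeasurable
      (hd t).aestronglyMeasurable hq).trans ?_
    rw [eLpNorm_const_smul, Real.enorm_eq_ofReal hα]
    calc _ ≤ ENNReal.ofReal α * (‖x₀‖ₑ + ENNReal.ofReal (1 - α)⁻¹ * D) + D := by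
          gcongr; exact hD t
      _ = ENNReal.ofReal α * ‖x₀‖ₑ +
          (ENNReal.ofReal α * (ENNReal.ofReal (1 - α)⁻¹ * D) + D) := by ring
      _ ≤ _ := by
          rw [ofReal_mul_inv_one_sub_add hα hα1]
          gcongr
          exact mul_le_of_le_one_left zero_le (ENNReal.ofReal_le_one.2 hα1.le)

lemma tendsto_eLpNorm_zero_of_dominated {p : ℝ} (hp : 0 < p) {f : ℕ → Ω → ℝ} {F : Ω → ℝ}
    (hf : ∀ t, AEStronglyMeasurable (f t) μ) (hF : eLpNorm F (ENNReal.ofReal p) μ ≠ ∞)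
    (hfF : ∀ t ω, |f t ω| ≤ F ω) (hlim : ∀ᵐ ω ∂μ, Tendsto (fun t => f t ω) atTop (nhds 0)) :
    Tendsto (fun t => eLpNorm (f t) (ENNReal.ofReal p) μ) atTop (nhds 0) := by
  have hp0 : ENNReal.ofReal p ≠ 0 := (ENNReal.ofReal_pos.2 hp).ne'
  have hpt : (ENNReal.ofReal p).toReal = p := ENNReal.toReal_ofReal hp.le
  have key : Tendsto (fun t => ∫⁻ ω, ‖f t ω‖ₑ ^ p ∂μ) atTop (nhds (∫⁻ _, 0 ∂μ)) := by
    refine tendsto_lintegral_of_dominated_convergence' (fun ω => ‖F ω‖ₑ ^ p)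
      (fun t => (hf t).enorm.pow_const p) (fun t => ae_of_all _ fun ω => ?_) ?_ ?_
    · refine ENNReal.rpow_le_rpow ?_ hp.le
      rw [enorm_le_iff_norm_le, Real.norm_eq_abs, Real.norm_eq_abs]
      exact (hfF t ω).trans (le_abs_self _)
    · have h1 := lintegral_rpow_enorm_lt_top_of_eLpNorm_lt_top hp0 ENNReal.ofReal_ne_top
        (lt_top_iff_ne_top.2 hF)
      rw [hpt] at h1
      exact h1.ne
    · filter_upwards [hlim] with ω hω
      have h1 : Tendsto (fun t => ‖f t ω‖ₑ) atTop (nhds 0) := by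
        simpa using hω.enorm
      have h2 := (ENNReal.continuous_rpow_const (y := p)).continuousAt.tendsto.comp h1
      simpa [ENNReal.zero_rpow_of_pos hp, Function.comp_def] using h2
  simp only [lintegral_zero] at key
  have h3 := (ENNReal.continuous_rpow_const (y := 1 / p)).continuousAt.tendsto.comp key
  simp only [Function.comp_def, ENNReal.zero_rpow_of_pos (one_div_pos.2 hp)] at h3
  simpa only [eLpNorm_eq_lintegral_rpow_enorm_toReal hp0 ENNReal.ofReal_ne_top, hpt] using h3

/-- A sequence bounded in `L¹` is `o(α ^ (-t))` almost surely. -/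
lemma ae_tendsto_mul_pow_zero {α : ℝ} (hα : 0 ≤ α) (hα1 : α < 1) {f : ℕ → Ω → ℝ}
    (hf : ∀ t, AEStronglyMeasurable (f t) μ) {K : ℝ≥0∞} (hK : K ≠ ∞)
    (hfK : ∀ t, eLpNorm (f t) 1 μ ≤ K) :
    ∀ᵐ ω ∂μ, Tendsto (fun t => f t ω * α ^ t) atTop (nhds 0) := by
  have hmeas : ∀ t, AEMeasurable (fun ω => ‖f t ω * α ^ t‖ₑ) μ := fun t =>
    ((hf t).mul_const (α ^ t)).enorm
  -- The series has mean at most K/(1 - α), so it converges almost surely and its terms vanish.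
  have hsum : ∫⁻ ω, ∑' t, ‖f t ω * α ^ t‖ₑ ∂μ ≠ ∞ := by
    rw [lintegral_tsum hmeas]
    have h1 : ∀ t, ∫⁻ ω, ‖f t ω * α ^ t‖ₑ ∂μ ≤ K * ENNReal.ofReal α ^ t := by
      intro t
      have h2 : ∀ ω, ‖f t ω * α ^ t‖ₑ = ‖f t ω‖ₑ * ENNReal.ofReal α ^ t := fun ω => by
        rw [enorm_mul, enorm_pow, Real.enorm_eq_ofReal hα]
      simp only [h2]
      rw [lintegral_mul_const'' _ (hf t).enorm]
      gcongr
      rw [← eLpNorm_one_eq_lintegral_enorm]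
      exact hfK t
    refine ne_top_of_le_ne_top ?_ (ENNReal.tsum_le_tsum h1)
    rw [ENNReal.tsum_mul_left, ENNReal.tsum_geometric]
    refine ENNReal.mul_ne_top hK (ENNReal.inv_ne_top.2 ?_)
    rw [← ENNReal.ofReal_one, ← ENNReal.ofReal_sub _ hα]
    exact (ENNReal.ofReal_pos.2 (by linarith)).ne'
  filter_upwards [ae_lt_top' (AEMeasurable.tsum hmeas) hsum] with ω hω
  have h1 := ENNReal.tendsto_atTop_zero_of_tsum_ne_top hω.ne
  rw [tendsto_zero_iff_norm_tendsto_zero]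
  have h2 := (ENNReal.tendsto_toReal ENNReal.zero_ne_top).comp h1
  simpa [Function.comp_def] using h2

end LpTools

/-! ### Moments of the random bound of the gain matrices -/

section GainBound

variable {n m : ℕ} {Ω : Type*}

/-- The random bound of the gain matrices after the block `T`. -/
def gainBound (K β : ℝ) (h : ℕ) (φ : ℕ → Fin n → Ω → Vec m) (T : ℕ) (ω : Ω) : ℝ :=
  K * (1 + ∑ r ∈ Finset.range (T + 1),
    (poorlyExcited h φ T r).indicator (fun _ => (β⁻¹) ^ (r + 1)) ω)

lemma gainBound_lower {K β : ℝ} (hK : 0 ≤ K) (hβ : 0 < β) {h : ℕ}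
    {φ : ℕ → Fin n → Ω → Vec m} {T r : ℕ} {ω : Ω} (hr : r ≤ T)
    (hω : ω ∈ poorlyExcited h φ T r) : K * (β⁻¹) ^ (r + 1) ≤ gainBound K β h φ T ω := by
  refine mul_le_mul_of_nonneg_left ?_ hK
  have h0 : ∀ r, 0 ≤ (poorlyExcited h φ T r).indicator (fun _ => (β⁻¹) ^ (r + 1)) ω := fun r =>
    Set.indicator_nonneg (fun _ _ => by positivity) ω
  have h1 := Finset.single_le_sum (f := fun r =>
    (poorlyExcited h φ T r).indicator (fun _ => (β⁻¹) ^ (r + 1)) ω) (fun r _ => h0 r)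
    (Finset.mem_range.2 (Nat.lt_succ_of_le hr))
  simp only [Set.indicator_of_mem hω] at h1
  linarith

lemma gainBound_ge {K β : ℝ} (hK : 0 ≤ K) (hβ : 0 < β) (h : ℕ)
    (φ : ℕ → Fin n → Ω → Vec m) (T : ℕ) (ω : Ω) : K ≤ gainBound K β h φ T ω := by
  refine le_mul_of_one_le_right hK ?_
  have h0 : 0 ≤ ∑ r ∈ Finset.range (T + 1),
      (poorlyExcited h φ T r).indicator (fun _ => (β⁻¹) ^ (r + 1)) ω :=
    Finset.sum_nonneg fun r _ => Set.indicator_nonneg (fun _ _ => by positivity) ω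
  linarith

/-- Take the shortest window r that is not poorly excited: information is then of order β^r, and for
r > 0 the failure of r - 1 puts β^{-r} into the sum defining `gainBound`. If all windows fail, the
term r = T covers the bound by the initial matrices. -/
lemma norm_le_gainBound (hm : 0 < m) (G : Network n) (hG : G.graph.Connected) {α : ℝ}
    (hα : 0 < α) (hα1 : α < 1) {P₀ : Fin n → Matrix (Fin m) (Fin m) ℝ}
    (hP₀ : ∀ i, (P₀ i).PosDef) (h : ℕ) :
    ∃ K : ℝ, 0 < K ∧ ∀ (φ : ℕ → Fin n → Ω → Vec m) (T t : ℕ),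
      (T + 1) * h + G.diameter + 1 ≤ t → t ≤ (T + 2) * h + G.diameter + 1 →
      ∀ (ω : Ω) (i : Fin n) (u : Vec m), ‖u‖ ≤ gainBound K (α ^ h) h φ T ω *
        ‖(WithLp.toLp 2 (infoMat G α P₀ (fun s j => φ s j ω) t i *ᵥ u.ofLp) : Vec m)‖ := by
  obtain ⟨c, hc, hcu⟩ := infoMat_quad_initial_lower G hα hP₀
  have ha := G.aMin_pos hG
  set κ₁ := G.aMin * α ^ (h + G.diameter) / 8
  set κ₂ := c * α ^ (h + G.diameter + 1)
  have hκ₁ : 0 < κ₁ := by positivity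
  have hκ₂ : 0 < κ₂ := by positivity
  set K := max κ₁⁻¹ κ₂⁻¹
  have hK : 0 < K := lt_max_of_lt_left (inv_pos.2 hκ₁)
  refine ⟨K, hK, fun φ T t ht ht' ω i u => ?_⟩
  set β := α ^ h with hβdef
  have hβ : 0 < β := by positivity
  set z := ‖(WithLp.toLp 2 (infoMat G α P₀ (fun s j => φ s j ω) t i *ᵥ u.ofLp) : Vec m)‖
  -- a quadratic lower bound of order `β ^ r` gives the claim if the gain bound is large enough
  have conclude : ∀ (κ : ℝ) (r : ℕ), 0 < κ → κ⁻¹ ≤ K →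
      κ * β ^ r * ‖u‖ ^ 2 ≤ u.ofLp ⬝ᵥ infoMat G α P₀ (fun s j => φ s j ω) t i *ᵥ u.ofLp →
      K * (β⁻¹) ^ r ≤ gainBound K β h φ T ω → ‖u‖ ≤ gainBound K β h φ T ω * z := by
    intro κ r hκ hκK hq hb
    have h1 := norm_le_of_quad_lower hq
    have h2 : ‖u‖ ≤ (κ * β ^ r)⁻¹ * z := by
      rw [inv_mul_eq_div, le_div_iff₀ (by positivity), mul_comm]
      exact h1
    refine h2.trans (mul_le_mul_of_nonneg_right (le_trans ?_ hb) (norm_nonneg _))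
    rw [mul_inv, inv_pow]
    gcongr
  by_cases hex : ∃ r, r ≤ T ∧ ω ∉ poorlyExcited h φ T r
  · classical
    obtain ⟨hrT, hrω⟩ := Nat.find_spec hex
    have hmin := fun r' (h' : r' < Nat.find hex) => Nat.find_min hex h'
    set r := Nat.find hex
    refine conclude κ₁ r hκ₁ (le_max_left _ _) ?_ ?_
    · refine le_trans ?_
        (infoMat_quad_lower G hα hα1 hP₀ hG φ h ω u.ofLp hrT ht ht' i)
      calc κ₁ * β ^ r * ‖u‖ ^ 2 =
          G.aMin * α ^ (h + G.diameter) * (α ^ h) ^ r * (‖u‖ ^ 2 / 8) := by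
            simp only [κ₁, hβdef]; ring
        _ ≤ _ := mul_le_mul_of_nonneg_left (quad_lower_of_notMem hm hrT hrω u) (by positivity)
    · rcases Nat.eq_zero_or_pos r with h0 | h0
      · rw [h0, pow_zero, mul_one]
        exact gainBound_ge hK.le hβ h φ T ω
      · obtain ⟨s, hs⟩ := Nat.exists_eq_succ_of_ne_zero h0.ne'
        have := hmin s (by omega)
        simp only [not_and, not_not] at this
        rw [hs]
        exact gainBound_lower hK.le hβ (by omega) (this (by omega))
  · push Not at hex
    refine conclude κ₂ (T + 1) hκ₂ (le_max_right _ _) ?_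
      (gainBound_lower hK.le hβ le_rfl (hex T le_rfl))
    refine le_trans ?_ (hcu _ t i u)
    have h1 : β ^ (T + 1) * α ^ (h + G.diameter + 1) ≤ α ^ t := by
      rw [hβdef, ← pow_mul, ← pow_add]
      refine pow_le_pow_of_le_one hα.le hα1.le ?_
      have : (T + 2) * h = h * (T + 1) + h := by ring
      omega
    calc κ₂ * β ^ (T + 1) * ‖u‖ ^ 2 =
        (β ^ (T + 1) * α ^ (h + G.diameter + 1)) * (c * ‖u‖ ^ 2) := by simp only [κ₂]; ring
      _ ≤ _ := mul_le_mul_of_nonneg_right h1 (by positivity)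

variable [mΩ : MeasurableSpace Ω] {μ : Measure Ω}
  {𝓕 : Filtration ℕ mΩ} {h : ℕ} {φ : ℕ → Fin n → Ω → Vec m}

lemma measurable_gainBound (hφ : ∀ i, StronglyAdapted 𝓕 fun t => φ t i) (K β : ℝ) (T : ℕ) :
    Measurable (gainBound K β h φ T) :=
  (measurable_const.add (Finset.measurable_sum _ fun r _ =>
    measurable_const.indicator (measurableSet_poorlyExcited hφ T r))).const_mul K

/-- By Minkowski, a window of length r contributes β^{-(r+1)} times the q-th root of a probability
of order (r + 1)^m ρ^r. This is summable because ρ^{1/q} < β. -/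
lemma eLpNorm_gainBound_le [IsProbabilityMeasure μ] (hm : 0 < m) (hh : 0 < h) {ρ β q : ℝ}
    (hρ : 0 < ρ) (hβ : 0 < β) (hq : 1 ≤ q) (hρβ : ρ ^ (1 / q) < β)
    (hexc : CooperativeExcitation μ 𝓕 h (ρ ^ (4 * h + 1)) φ) (K : ℝ) :
    ∃ B : ℝ≥0∞, B ≠ ∞ ∧ ∀ T, eLpNorm (gainBound K β h φ T) (ENNReal.ofReal q) μ ≤ B := by
  obtain ⟨C, hC1, hC⟩ := measure_poorlyExcited_le hm hh hρ hexc
  have hq0 : 0 < q := by linarith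
  have hqE : (1 : ℝ≥0∞) ≤ ENNReal.ofReal q := by simpa using hq
  have hqE0 : ENNReal.ofReal q ≠ 0 := (ENNReal.ofReal_pos.2 hq0).ne'
  set g := ρ ^ (1 / q) * β⁻¹ with hg
  have hρq : 0 < ρ ^ (1 / q) := Real.rpow_pos_of_pos hρ _
  have hg0 : 0 < g := by positivity
  have hg1 : g < 1 := by rw [hg, ← div_eq_mul_inv, div_lt_one hβ]; exact hρβ
  set b : ℕ → ℝ := fun r => C * β⁻¹ * ((r + 1 : ℝ) ^ m * g ^ r) with hb
  have hb0 : ∀ r, 0 ≤ b r := fun r => by positivity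
  have hsum : Summable b := by
    refine Summable.mul_left _ ?_
    have h1 := summable_pow_mul_geometric_of_norm_lt_one m
      (by rwa [Real.norm_of_nonneg hg0.le] : ‖g‖ < 1)
    have h2 := ((summable_nat_add_iff 1).2 h1).mul_left g⁻¹
    refine h2.congr fun r => ?_
    push_cast
    rw [pow_succ g r]
    field_simp
  have hterm : ∀ T r, r ≤ T →
      eLpNorm ((poorlyExcited h φ T r).indicator fun _ => (β⁻¹) ^ (r + 1))
        (ENNReal.ofReal q) μ ≤ ENNReal.ofReal (b r) := by
    intro T r hr
    rw [eLpNorm_indicator_const (measurableSet_poorlyExcited hexc.1 T r) hqE0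
      ENNReal.ofReal_ne_top, ENNReal.toReal_ofReal hq0.le,
      Real.enorm_eq_ofReal (by positivity), ← ofReal_measureReal,
      ENNReal.ofReal_rpow_of_nonneg measureReal_nonneg (by positivity),
      ← ENNReal.ofReal_mul (by positivity)]
    refine ENNReal.ofReal_le_ofReal ?_
    have h1 : μ.real (poorlyExcited h φ T r) ^ (1 / q) ≤
        C * (r + 1 : ℝ) ^ m * (ρ ^ (1 / q)) ^ r := by
      refine (Real.rpow_le_rpow measureReal_nonneg (hC T r hr) (by positivity)).trans ?_
      have hC0 : 0 ≤ C := by linarith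
      rw [← mul_assoc, Real.mul_rpow (by positivity) (by positivity)]
      refine mul_le_mul ?_ (le_of_eq ?_) (by positivity) (by positivity)
      · have h2 : 1 ≤ C * (r + 1 : ℝ) ^ m :=
          one_le_mul_of_one_le_of_one_le hC1 (one_le_pow₀ (by
            have : (0 : ℝ) ≤ r := Nat.cast_nonneg r
            linarith))
        calc _ ≤ (C * (r + 1 : ℝ) ^ m) ^ (1 : ℝ) :=
              Real.rpow_le_rpow_of_exponent_le h2 ((div_le_one hq0).2 hq)
          _ = _ := Real.rpow_one _
      · rw [← Real.rpow_natCast, ← Real.rpow_natCast, ← Real.rpow_mul hρ.le,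
          ← Real.rpow_mul hρ.le, mul_comm]
    calc _ ≤ (β⁻¹) ^ (r + 1) * (C * (r + 1 : ℝ) ^ m * (ρ ^ (1 / q)) ^ r) :=
          mul_le_mul_of_nonneg_left h1 (by positivity)
      _ = b r := by simp only [hb, hg, mul_pow]; ring
  refine ⟨‖K‖ₑ * (1 + ENNReal.ofReal (∑' r, b r)),
    ENNReal.mul_ne_top enorm_ne_top (ENNReal.add_ne_top.2
      ⟨ENNReal.one_ne_top, ENNReal.ofReal_ne_top⟩), fun T => ?_⟩
  have hmeas : ∀ r, AEStronglyMeasurable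
      ((poorlyExcited h φ T r).indicator fun _ => (β⁻¹) ^ (r + 1)) μ := fun r =>
    (measurable_const.indicator (measurableSet_poorlyExcited hexc.1 T r)).aestronglyMeasurable
  have hfun : gainBound K β h φ T = K • ((fun _ => (1 : ℝ)) + ∑ r ∈ Finset.range (T + 1),
      (poorlyExcited h φ T r).indicator fun _ => (β⁻¹) ^ (r + 1)) := by
    ext ω
    simp [gainBound, Finset.sum_apply]
  rw [hfun, eLpNorm_const_smul]
  gcongr
  refine (eLpNorm_add_le aestronglyMeasurable_const
    (Finset.aestronglyMeasurable_sum _ fun r _ => hmeas r) hqE).trans ?_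
  refine add_le_add ?_ ?_
  · rw [eLpNorm_const _ hqE0 (IsProbabilityMeasure.ne_zero μ)]
    simp
  · refine (eLpNorm_sum_le (fun r _ => hmeas r) hqE).trans ?_
    refine (Finset.sum_le_sum fun r hr =>
      hterm T r (Nat.lt_succ_iff.1 (Finset.mem_range.1 hr))).trans ?_
    rw [← ENNReal.ofReal_sum_of_nonneg fun r _ => hb0 r]
    exact ENNReal.ofReal_le_ofReal (hsum.sum_le_tsum _ fun r _ => hb0 r)

end GainBound

/-! ### The pointwise bound of the tracking error -/

section Tracking

variable {n m : ℕ} {Ω : Type*}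

/-- The block that ends last among those that have reached all sensors at time `t`. -/
def lastBlock (h D t : ℕ) : ℕ := (t - D - 1) / h - 1

lemma lastBlock_spec {h D t : ℕ} (hh : 0 < h) (ht : h + D + 1 ≤ t) :
    (lastBlock h D t + 1) * h + D + 1 ≤ t ∧ t ≤ (lastBlock h D t + 2) * h + D + 1 := by
  have h1 : 1 ≤ (t - D - 1) / h := (Nat.one_le_div_iff hh).2 (by omega)
  have h2 : lastBlock h D t + 1 = (t - D - 1) / h := by rw [lastBlock]; omega
  have h3 := Nat.div_mul_le_self (t - D - 1) h
  have h4 := Nat.lt_div_mul_add (a := t - D - 1) hh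
  have h5 : (lastBlock h D t + 2) * h = (t - D - 1) / h * h + h := by
    rw [← h2]; ring
  rw [h2, h5]
  omega

/-- The scalar bound of the information matrices. -/
def infoBound (α ρ₀ : ℝ) (φ : ℕ → Fin n → Ω → Vec m) (t : ℕ) (ω : Ω) : ℝ :=
  forget α ρ₀ (fun s => ∑ j, ‖φ s j ω‖ ^ 2) t

/-- The disturbance that enters the transformed error recursion at time `s`. -/
def forcing (α ρ₀ : ℝ) (φ : ℕ → Fin n → Ω → Vec m) (w : ℕ → Fin n → Ω → ℝ) (θ : ℕ → Ω → Vec m)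
    (s : ℕ) (ω : Ω) : ℝ :=
  infoBound α ρ₀ φ (s + 1) ω * ‖θ (s + 1) ω - θ s ω‖ + ∑ j, ‖φ s j ω‖ * |w (s + 1) j ω|

/-- The accumulated disturbance in the transformed error recursion. -/
def accumulatedForcing (α ρ₀ : ℝ) (φ : ℕ → Fin n → Ω → Vec m) (w : ℕ → Fin n → Ω → ℝ)
    (θ : ℕ → Ω → Vec m) (t : ℕ) (ω : Ω) : ℝ :=
  forget α 0 (fun s => forcing α ρ₀ φ w θ s ω) t

lemma infoBound_nonneg {α ρ₀ : ℝ} (hα : 0 < α) (hρ₀ : 0 ≤ ρ₀) (φ : ℕ → Fin n → Ω → Vec m) (t : ℕ)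
    (ω : Ω) : 0 ≤ infoBound α ρ₀ φ t ω :=
  forget_nonneg hα.le hρ₀ (fun _ => Finset.sum_nonneg fun _ _ => sq_nonneg _) t

lemma accumulatedForcing_nonneg {α ρ₀ : ℝ} (hα : 0 < α) (hρ₀ : 0 ≤ ρ₀)
    (φ : ℕ → Fin n → Ω → Vec m) (w : ℕ → Fin n → Ω → ℝ) (θ : ℕ → Ω → Vec m) (t : ℕ) (ω : Ω) :
    0 ≤ accumulatedForcing α ρ₀ φ w θ t ω :=
  forget_nonneg hα.le le_rfl (fun _ => add_nonneg
    (mul_nonneg (infoBound_nonneg hα hρ₀ φ _ ω) (norm_nonneg _))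
    (Finset.sum_nonneg fun _ _ => mul_nonneg (norm_nonneg _) (abs_nonneg _))) t

/-- The pointwise bound of the tracking error by the accumulated disturbance and by a bounded
multiple of the initial error that vanishes in the limit. -/
lemma norm_trackingError_le (hm : 0 < m) (G : Network n) (hG : G.graph.Connected) {α : ℝ}
    (hα : 0 < α) (hα1 : α < 1) {P₀ : Fin n → Matrix (Fin m) (Fin m) ℝ}
    (hP₀ : ∀ i, (P₀ i).PosDef) {h : ℕ} (hh : 0 < h) :
    ∃ K c ρ₀ : ℝ, 0 < K ∧ 0 < c ∧ 0 ≤ ρ₀ ∧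
      ∀ (φ : ℕ → Fin n → Ω → Vec m) (θ : ℕ → Ω → Vec m) (w y : ℕ → Fin n → Ω → ℝ)
        (θ₀ : Fin n → Ω → Vec m),
        (∀ t i ω, y (t + 1) i ω = (φ t i ω).ofLp ⬝ᵥ (θ t ω).ofLp + w (t + 1) i ω) →
        ∀ t, h + G.diameter + 1 ≤ t → ∀ ω,
          ‖trackingError G α P₀ θ₀ φ y θ t ω‖ ≤
            n * (gainBound K (α ^ h) h φ (lastBlock h G.diameter t) ω *
                accumulatedForcing α ρ₀ φ w θ t ω +
              min (gainBound K (α ^ h) h φ (lastBlock h G.diameter t) ω * α ^ t) c *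
                ∑ j, ρ₀ * ‖θ 0 ω - θ₀ j ω‖) := by
  obtain ⟨K, hK, hKu⟩ := norm_le_gainBound (Ω := Ω) hm G hG hα hα1 hP₀ h
  obtain ⟨c, hc, hcu⟩ := infoMat_quad_initial_lower G hα hP₀
  obtain ⟨ρ₀, hρ₀, hρu⟩ := infoMat_norm_le G hα hP₀
  refine ⟨K, c⁻¹, ρ₀, hK, inv_pos.2 hc, hρ₀, fun φ θ w y θ₀ hy t ht ω => ?_⟩
  obtain ⟨hT1, hT2⟩ := lastBlock_spec hh ht
  set T := lastBlock h G.diameter t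
  set Γ := gainBound K (α ^ h) h φ T ω
  have hΓ : 0 ≤ Γ := hK.le.trans (gainBound_ge hK.le (by positivity) h φ T ω)
  set ν := accumulatedForcing α ρ₀ φ w θ t ω
  have hν : 0 ≤ ν := accumulatedForcing_nonneg hα hρ₀ φ w θ t ω
  set ζ := ∑ j, ρ₀ * ‖θ 0 ω - θ₀ j ω‖
  have hζ : 0 ≤ ζ := Finset.sum_nonneg fun j _ => mul_nonneg hρ₀ (norm_nonneg _)
  have hαt : 0 < α ^ t := by positivity
  have hsensor : ∀ i, ‖θ t ω - estimate G α P₀ (fun j => θ₀ j ω) (fun s j => φ s j ω)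
      (fun s j => y s j ω) t i‖ ≤ Γ * ν + min (Γ * α ^ t) c⁻¹ * ζ := by
    intro i
    set e := θ t ω - estimate G α P₀ (fun j => θ₀ j ω) (fun s j => φ s j ω)
      (fun s j => y s j ω) t i
    set z := ‖(WithLp.toLp 2 (infoMat G α P₀ (fun s j => φ s j ω) t i *ᵥ e.ofLp) : Vec m)‖
    have h1 : ‖e‖ ≤ Γ * z := hKu φ T t hT1 hT2 ω i e
    have h2 : α ^ t * c * ‖e‖ ≤ z := norm_le_of_quad_lower (by
      rw [mul_assoc]; exact hcu (fun s j => φ s j ω) t i e)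
    have h3 : z ≤ α ^ t * ζ + ν :=
      infoMat_error_le G hα hP₀ (fun s j => φ s j ω) (fun j => θ₀ j ω) (fun s j => y s j ω)
        (fun s j => w s j ω) (fun s => θ s ω) (fun t i => hy t i ω)
        (ρ := fun t => infoBound α ρ₀ φ t ω) (fun t i v => hρu _ t i v) t i
    have hz : 0 ≤ z := norm_nonneg _
    -- Use whichever of Γ and c⁻¹ α^{-t} is smaller as the factor of z. The second turns α^t ζ into
    -- c⁻¹ ζ, and being at most Γ it keeps the disturbance term below Γ ν.
    rcases le_total (Γ * α ^ t) c⁻¹ with hle | hle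
    · rw [min_eq_left hle]
      calc ‖e‖ ≤ Γ * z := h1
        _ ≤ Γ * (α ^ t * ζ + ν) := mul_le_mul_of_nonneg_left h3 hΓ
        _ = _ := by ring
    · rw [min_eq_right hle]
      have h4 : ‖e‖ ≤ c⁻¹ * (α ^ t)⁻¹ * z := by
        rw [← mul_inv, inv_mul_eq_div, le_div_iff₀ (by positivity)]
        linarith
      have h5 : c⁻¹ * (α ^ t)⁻¹ ≤ Γ := by
        rw [← div_eq_mul_inv, div_le_iff₀ hαt]; exact hle
      calc ‖e‖ ≤ c⁻¹ * (α ^ t)⁻¹ * (α ^ t * ζ + ν) :=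
            h4.trans (mul_le_mul_of_nonneg_left h3 (by positivity))
        _ = c⁻¹ * (α ^ t)⁻¹ * ν + c⁻¹ * ζ := by field_simp; ring
        _ ≤ _ := by gcongr
  refine (norm_stack_le _).trans ((Finset.sum_le_sum fun i _ => hsensor i).trans (le_of_eq ?_))
  simp [mul_add]

end Tracking

/-! ### Moments of the disturbances -/

section Moments

variable {n m : ℕ} {Ω : Type*} [mΩ : MeasurableSpace Ω] {μ : Measure Ω}

lemma LNorm_noise_le (w : ℕ → Fin n → Ω → ℝ) (θ : ℕ → Ω → Vec m) (q : ℝ) (t : ℕ) (j : Fin n) :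
    eLpNorm (fun ω => |w t j ω|) (ENNReal.ofReal q) μ ≤ disturbanceLevel μ q w θ := by
  refine le_trans ?_ (le_iSup _ t)
  refine le_trans ?_ (le_add_of_nonneg_right zero_le)
  refine eLpNorm_mono fun ω => ?_
  simpa using PiLp.norm_apply_le (WithLp.toLp 2 fun i => w t i ω : Vec n) j

lemma norm_le_norm_stack (v : Fin n → Vec m) (i : Fin n) : ‖v i‖ ≤ ‖stack v‖ := by
  refine le_of_sq_le_sq ?_ (norm_nonneg _)
  simp only [EuclideanSpace.real_norm_sq_eq, stack, Fintype.sum_prod_type]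
  exact Finset.single_le_sum (f := fun i => ∑ k, v i k ^ 2)
    (fun i _ => Finset.sum_nonneg fun _ _ => sq_nonneg _) (Finset.mem_univ i)

/-- One of the n stacked copies suffices; with n = 0 the stack would not see the drift. -/
lemma LNorm_drift_le (hn : 0 < n) (w : ℕ → Fin n → Ω → ℝ) (θ : ℕ → Ω → Vec m) (q : ℝ) (t : ℕ) :
    eLpNorm (fun ω => ‖θ (t + 1) ω - θ t ω‖) (ENNReal.ofReal q) μ ≤
      disturbanceLevel μ q w θ := by
  refine le_trans ?_ (le_iSup _ t)
  refine le_trans ?_ (le_add_of_nonneg_left zero_le)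
  refine eLpNorm_mono fun ω => ?_
  rw [norm_norm]
  exact norm_le_norm_stack (fun _ : Fin n => θ (t + 1) ω - θ t ω) ⟨0, hn⟩

variable [IsProbabilityMeasure μ]

lemma eLpNorm_infoBound_le {φ : ℕ → Fin n → Ω → Vec m} (hφm : ∀ t i, Measurable (φ t i)) {p : ℝ}
    (hp : 1 ≤ p) {α : ℝ} (hα : 0 < α) (hα1 : α < 1) (ρ₀ : ℝ) (t : ℕ) :
    eLpNorm (infoBound α ρ₀ φ t) (ENNReal.ofReal (3 * p)) μ ≤ ‖ρ₀‖ₑ +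
      ENNReal.ofReal (1 - α)⁻¹ * ∑ j, supLNorm μ (6 * p) (fun t => φ t j) ^ 2 := by
  refine eLpNorm_forget_le hα.le hα1 (d := fun s ω => ∑ j, ‖φ s j ω‖ ^ 2)
    (fun s => Finset.measurable_sum _ fun j _ => (hφm s j).norm.pow_const 2)
    (ENNReal.one_le_ofReal.2 (by linarith)) (fun s => ?_) t
  have h1 : (fun ω => ∑ j, ‖φ s j ω‖ ^ 2) = ∑ j, fun ω => ‖φ s j ω‖ * ‖φ s j ω‖ := by
    ext ω
    simp [sq]
  simp only [h1]
  refine (eLpNorm_sum_le (fun j _ => ((hφm s j).norm.mul (hφm s j).norm).aestronglyMeasurable)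
    (ENNReal.one_le_ofReal.2 (by linarith))).trans (Finset.sum_le_sum fun j _ => ?_)
  refine (eLpNorm_mul_le_ofReal (a := 6 * p) (b := 6 * p) (by linarith) (by linarith)
    (by linarith) (by field_simp; norm_num) (hφm s j).norm.aestronglyMeasurable
    (hφm s j).norm.aestronglyMeasurable).trans ?_
  rw [eLpNorm_norm, sq]
  have h2 : eLpNorm (φ s j) (ENNReal.ofReal (6 * p)) μ ≤ supLNorm μ (6 * p) fun t => φ t j :=
    le_iSup (fun t => LNorm μ (6 * p) (φ t j)) s
  gcongr

lemma measurable_infoBound {φ : ℕ → Fin n → Ω → Vec m} (hφm : ∀ t i, Measurable (φ t i))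
    (α ρ₀ : ℝ) (t : ℕ) : Measurable (infoBound α ρ₀ φ t) :=
  measurable_forget (d := fun s ω => ∑ j, ‖φ s j ω‖ ^ 2)
    (fun s => Finset.measurable_sum _ fun j _ => (hφm s j).norm.pow_const 2) t

lemma measurable_forcing {φ : ℕ → Fin n → Ω → Vec m} (hφm : ∀ t i, Measurable (φ t i))
    {w : ℕ → Fin n → Ω → ℝ} (hw : ∀ t i, Measurable (w t i)) {θ : ℕ → Ω → Vec m}
    (hθ : ∀ t, Measurable (θ t)) (α ρ₀ : ℝ) (s : ℕ) : Measurable (forcing α ρ₀ φ w θ s) :=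
  ((measurable_infoBound hφm α ρ₀ (s + 1)).mul ((hθ (s + 1)).sub (hθ s)).norm).add
    (Finset.measurable_sum _ fun j _ => (hφm s j).norm.mul (hw (s + 1) j).norm)

/-- The drift meets the information bound and the noise meets the regressor. All four factors are in
L_{3p}, so the products are in L_{3p/2}. -/
lemma eLpNorm_accumulatedForcing_le (hn : 0 < n) {φ : ℕ → Fin n → Ω → Vec m}
    (hφm : ∀ t i, Measurable (φ t i))
    {w : ℕ → Fin n → Ω → ℝ} (hw : ∀ t i, Measurable (w t i)) {θ : ℕ → Ω → Vec m}
    (hθ : ∀ t, Measurable (θ t)) {p : ℝ} (hp : 1 ≤ p) {α : ℝ} (hα : 0 < α) (hα1 : α < 1) (ρ₀ : ℝ)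
    (t : ℕ) :
    eLpNorm (accumulatedForcing α ρ₀ φ w θ t) (ENNReal.ofReal (3 * p / 2)) μ ≤
      ENNReal.ofReal (1 - α)⁻¹ * ((‖ρ₀‖ₑ + ENNReal.ofReal (1 - α)⁻¹ *
        ∑ j, supLNorm μ (6 * p) (fun t => φ t j) ^ 2 +
        ∑ j, supLNorm μ (6 * p) (fun t => φ t j)) * disturbanceLevel μ (3 * p) w θ) := by
  have hq : 1 ≤ ENNReal.ofReal (3 * p / 2) := ENNReal.one_le_ofReal.2 (by linarith)
  set σ := disturbanceLevel μ (3 * p) w θ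
  have hf := eLpNorm_forget_le (μ := μ) (x₀ := 0) hα.le hα1
    (fun s => measurable_forcing hφm hw hθ α ρ₀ s) hq (D := (‖ρ₀‖ₑ + ENNReal.ofReal (1 - α)⁻¹ *
        ∑ j, supLNorm μ (6 * p) (fun t => φ t j) ^ 2 +
        ∑ j, supLNorm μ (6 * p) (fun t => φ t j)) * σ) (fun s => ?_) t
  · rw [enorm_zero, zero_add] at hf
    exact hf
  have h1 : forcing α ρ₀ φ w θ s =
      (fun ω => infoBound α ρ₀ φ (s + 1) ω * ‖θ (s + 1) ω - θ s ω‖) +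
      ∑ j, fun ω => ‖φ s j ω‖ * |w (s + 1) j ω| := by
    ext ω
    simp [forcing]
  have hmw : ∀ j, Measurable fun ω => |w (s + 1) j ω| := fun j => (hw (s + 1) j).norm
  have hmθ : Measurable fun ω => ‖θ (s + 1) ω - θ s ω‖ := ((hθ (s + 1)).sub (hθ s)).norm
  have hexp : (3 * p)⁻¹ + (3 * p)⁻¹ = (3 * p / 2)⁻¹ := by field_simp; norm_num
  rw [h1, add_mul, Finset.sum_mul]
  refine (eLpNorm_add_le ((measurable_infoBound hφm α ρ₀ (s + 1)).mul hmθ).aestronglyMeasurable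
    (Finset.aestronglyMeasurable_sum _ fun j _ =>
      ((hφm s j).norm.mul (hmw j)).aestronglyMeasurable) hq).trans (add_le_add ?_ ?_)
  · refine (eLpNorm_mul_le_ofReal (a := 3 * p) (b := 3 * p) (by linarith) (by linarith)
      (by linarith) hexp (measurable_infoBound hφm α ρ₀ (s + 1)).aestronglyMeasurable
      hmθ.aestronglyMeasurable).trans ?_
    exact mul_le_mul' (eLpNorm_infoBound_le hφm hp hα hα1 ρ₀ (s + 1)) (LNorm_drift_le hn w θ _ s)
  · refine (eLpNorm_sum_le (fun j _ => ((hφm s j).norm.mul (hmw j)).aestronglyMeasurable)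
      hq).trans (Finset.sum_le_sum fun j _ => ?_)
    refine (eLpNorm_mul_le_ofReal (a := 3 * p) (b := 3 * p) (by linarith) (by linarith)
      (by linarith) hexp (hφm s j).norm.aestronglyMeasurable
      (hmw j).aestronglyMeasurable).trans (mul_le_mul' ?_ (LNorm_noise_le w θ _ (s + 1) j))
    rw [eLpNorm_norm]
    refine (eLpNorm_le_eLpNorm_of_exponent_le (ENNReal.ofReal_le_ofReal
      (by linarith : 3 * p ≤ 6 * p)) (hφm s j).aestronglyMeasurable).trans ?_
    exact le_iSup (fun t => LNorm μ (6 * p) (φ t j)) s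

end Moments

/-- The lower bound of the forgetting factor, in the form in which it is used. -/
lemma rate_lt_forgetting {lam : ℝ} (hlam : lam ∈ Set.Ioo (0 : ℝ) 1) {α p a : ℝ} (ha0 : 0 ≤ a)
    (ha1 : a ≤ 1) (hp : 1 ≤ p) {m h D : ℕ} (hm : 0 < m) (hh : 0 < h)
    (hα : lam ^ (a ^ 2 / (32 * p * m * h * (4 * h + D - 1))) < α) :
    (lam ^ (1 / (4 * h + 1 : ℝ))) ^ (1 / (3 * p)) < α ^ h := by
  have hm1 : (1 : ℝ) ≤ m := by exact_mod_cast hm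
  have hh1 : (1 : ℝ) ≤ h := by exact_mod_cast hh
  have hD0 : (0 : ℝ) ≤ D := Nat.cast_nonneg D
  set e := a ^ 2 / (32 * p * m * h * (4 * h + D - 1)) with he
  have hden : 0 < (4 * h + D - 1 : ℝ) := by linarith
  -- Since lam < 1, a smaller exponent gives a larger power. The target combines the loss 1/(4h + 1)
  -- of the tail estimate with the root of order 3p; a ≤ 1, m ≥ 1, h ≥ 1 and D ≥ 0 suffice.
  have hexp : e * h ≤ 1 / (4 * h + 1) * (1 / (3 * p)) := by
    have h1 : e * h = a ^ 2 / (32 * p * m * (4 * h + D - 1)) := by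
      rw [he]; field_simp
    rw [h1, one_div_mul_one_div, div_le_div_iff₀ (by positivity) (by positivity)]
    have h2 : a ^ 2 ≤ 1 := pow_le_one₀ ha0 ha1
    have h3 : (4 * h + 1 : ℝ) * (3 * p) ≤ 32 * p * 1 * (4 * h + D - 1) := by nlinarith
    calc a ^ 2 * ((4 * h + 1) * (3 * p)) ≤ 1 * (32 * p * 1 * (4 * h + D - 1)) :=
          mul_le_mul h2 h3 (by positivity) zero_le_one
      _ ≤ _ := by gcongr
  calc (lam ^ (1 / (4 * h + 1 : ℝ))) ^ (1 / (3 * p)) =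
        lam ^ (1 / (4 * h + 1) * (1 / (3 * p))) := (Real.rpow_mul hlam.1.le _ _).symm
    _ ≤ lam ^ (e * h) := Real.rpow_le_rpow_of_exponent_ge hlam.1 hlam.2.le hexp
    _ = (lam ^ e) ^ h := by rw [Real.rpow_mul hlam.1.le, Real.rpow_natCast]
    _ < α ^ h := pow_lt_pow_left₀ hα (Real.rpow_nonneg hlam.1.le _) hh.ne'

end DiffusionFFLS

end

/-! ### Assembly of the tracking bound -/

theorem theorem2 {n m : ℕ} (hm : 0 < m)
    {Ω : Type*} [mΩ : MeasurableSpace Ω] (μ : Measure Ω) [IsProbabilityMeasure μ]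
    (𝓕 : Filtration ℕ mΩ)
    -- the network
    (G : DiffusionFFLS.Network n) (hG : G.graph.Connected)
    -- the regressors and the cooperative excitation condition
    (φ : ℕ → Fin n → Ω → DiffusionFFLS.Vec m)
    (h : ℕ) (hh : 0 < h) (lam : ℝ) (hlam : lam ∈ Set.Ioo (0 : ℝ) 1)
    (hexc : DiffusionFFLS.CooperativeExcitation μ 𝓕 h lam φ)
    -- the order of the moments and the forgetting factor
    (p : ℝ) (hp : 1 ≤ p)
    (hφ : ∀ i, DiffusionFFLS.supLNorm μ (6 * p) (fun t => φ t i) < ∞)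
    (α : ℝ)
    (hα : lam ^ (G.aMin ^ 2 / (32 * p * m * h * (4 * h + G.diameter - 1))) < α) (hα1 : α < 1)
    -- the initial matrices
    (P₀ : Fin n → Matrix (Fin m) (Fin m) ℝ) (hP₀ : ∀ i, (P₀ i).PosDef) :
    ∃ c : ℝ, 0 < c ∧
      ∀ (θ : ℕ → Ω → DiffusionFFLS.Vec m) (w y : ℕ → Fin n → Ω → ℝ)
        (θ₀ : Fin n → Ω → DiffusionFFLS.Vec m),
        (∀ t, Measurable (θ t)) → (∀ t i, Measurable (w t i)) → (∀ i, Measurable (θ₀ i)) →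
        -- the observation model
        (∀ t i ω, y (t + 1) i ω = (φ t i ω).ofLp ⬝ᵥ (θ t ω).ofLp + w (t + 1) i ω) →
        -- the initial tracking errors have a finite moment of order `p`
        (∀ i, DiffusionFFLS.LNorm μ p (fun ω => θ 0 ω - θ₀ i ω) < ∞) →
        DiffusionFFLS.disturbanceLevel μ (3 * p) w θ < ∞ →
        limsup (fun t => DiffusionFFLS.LNorm μ p
            (DiffusionFFLS.trackingError G α P₀ θ₀ φ y θ t)) atTop ≤
          ENNReal.ofReal c * DiffusionFFLS.disturbanceLevel μ (3 * p) w θ := by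
  open DiffusionFFLS in
  have hα0 : 0 < α := (Real.rpow_pos_of_pos hlam.1 _).trans hα
  have hn : 0 < n := by
    obtain ⟨i⟩ := hG.nonempty
    exact i.pos
  have hp0 : 0 < p := by linarith
  have hpE : (1 : ℝ≥0∞) ≤ ENNReal.ofReal p := ENNReal.one_le_ofReal.2 hp
  have hrate := rate_lt_forgetting hlam (G.aMin_pos hG).le (G.aMin_le_one hG) hp hm hh hα
  set ρ := lam ^ (1 / (4 * h + 1 : ℝ))
  have hρ : 0 < ρ := Real.rpow_pos_of_pos hlam.1 _
  have hρlam : ρ ^ (4 * h + 1) = lam := by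
    rw [← Real.rpow_natCast, ← Real.rpow_mul hlam.1.le]
    push_cast
    rw [one_div, inv_mul_cancel₀ (by positivity), Real.rpow_one]
  have hφm : ∀ t i, Measurable (φ t i) := fun t i =>
    ((hexc.1 i t).mono (𝓕.le t)).measurable
  obtain ⟨K, κ, ρ₀, hK, hκ, hρ₀, herr⟩ :=
    norm_trackingError_le (Ω := Ω) hm G hG hα0 hα1 hP₀ hh
  obtain ⟨B, hB, hBT⟩ := eLpNorm_gainBound_le (q := 3 * p) hm hh hρ (pow_pos hα0 h)
    (by linarith) hrate (by rwa [hρlam]) K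
  set R : ℝ≥0∞ := ENNReal.ofReal (1 - α)⁻¹ * (‖ρ₀‖ₑ + ENNReal.ofReal (1 - α)⁻¹ *
    ∑ j, supLNorm μ (6 * p) (fun t => φ t j) ^ 2 + ∑ j, supLNorm μ (6 * p) (fun t => φ t j))
  have hR : R ≠ ∞ := by
    refine ENNReal.mul_ne_top ENNReal.ofReal_ne_top (ENNReal.add_ne_top.2
      ⟨ENNReal.add_ne_top.2 ⟨enorm_ne_top, ENNReal.mul_ne_top ENNReal.ofReal_ne_top ?_⟩, ?_⟩)
    · exact ENNReal.sum_ne_top.2 fun j _ => ENNReal.pow_ne_top (hφ j).ne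
    · exact ENNReal.sum_ne_top.2 fun j _ => (hφ j).ne
  set C : ℝ≥0∞ := n * (B * R)
  have hC : C ≠ ∞ := ENNReal.mul_ne_top (ENNReal.natCast_ne_top n) (ENNReal.mul_ne_top hB hR)
  -- Everything entering C was fixed before θ, w and θ₀; the added 1 makes the constant positive.
  refine ⟨C.toReal + 1, by positivity, fun θ w y θ₀ hθ hw hθ₀ hy hinit _ => ?_⟩
  set σ := disturbanceLevel μ (3 * p) w θ
  set Γ : ℕ → Ω → ℝ := fun t => gainBound K (α ^ h) h φ (lastBlock h G.diameter t)
  have hΓm : ∀ t, Measurable (Γ t) := fun t => measurable_gainBound hexc.1 K _ _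
  have hΓ0 : ∀ t ω, 0 ≤ Γ t ω := fun t ω =>
    hK.le.trans (gainBound_ge hK.le (pow_pos hα0 h) h φ _ ω)
  have hνm : ∀ t, Measurable (accumulatedForcing α ρ₀ φ w θ t) := fun t =>
    measurable_forget (fun s => measurable_forcing hφm hw hθ α ρ₀ s) t
  set ζ : Ω → ℝ := fun ω => ∑ j, ρ₀ * ‖θ 0 ω - θ₀ j ω‖
  have hζm : Measurable ζ :=
    Finset.measurable_sum _ fun j _ => ((hθ 0).sub (hθ₀ j)).norm.const_mul ρ₀
  have hζ0 : ∀ ω, 0 ≤ ζ ω := fun ω =>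
    Finset.sum_nonneg fun j _ => mul_nonneg hρ₀ (norm_nonneg _)
  have hζp : eLpNorm (fun ω => κ * ζ ω) (ENNReal.ofReal p) μ ≠ ∞ := by
    have h1 : MemLp ζ (ENNReal.ofReal p) μ := memLp_finsetSum _ fun j _ =>
      (MemLp.norm ⟨((hθ 0).sub (hθ₀ j)).aestronglyMeasurable, hinit j⟩).const_mul ρ₀
    exact (h1.const_mul κ).2.ne
  set ε : ℕ → Ω → ℝ := fun t ω => min (Γ t ω * α ^ t) κ * ζ ω
  have hεm : ∀ t, Measurable (ε t) := fun t =>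
    (((hΓm t).mul_const _).min measurable_const).mul hζm
  have hε0 : ∀ t ω, 0 ≤ min (Γ t ω * α ^ t) κ := fun t ω =>
    le_min (mul_nonneg (hΓ0 t ω) (pow_nonneg hα0.le t)) hκ.le
  -- the contribution of the initial error vanishes
  have hεlim : Tendsto (fun t => eLpNorm (ε t) (ENNReal.ofReal p) μ) atTop (nhds 0) := by
    -- With ζ only in L_p, the cap κ provides the dominating function κ ζ and Γ_t α^t → 0 the
    -- pointwise limit.
    refine tendsto_eLpNorm_zero_of_dominated hp0 (fun t => (hεm t).aestronglyMeasurable) hζp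
      (fun t ω => ?_) ?_
    · rw [abs_of_nonneg (mul_nonneg (hε0 t ω) (hζ0 ω))]
      exact mul_le_mul_of_nonneg_right (min_le_right _ _) (hζ0 ω)
    · have h1 := ae_tendsto_mul_pow_zero (μ := μ) hα0.le hα1
        (fun t => (hΓm t).aestronglyMeasurable) hB fun t =>
          (eLpNorm_le_eLpNorm_of_exponent_le (ENNReal.one_le_ofReal.2 (by linarith))
            (hΓm t).aestronglyMeasurable).trans (hBT (lastBlock h G.diameter t))
      filter_upwards [h1] with ω hω
      have h2 : Tendsto (fun t => min (Γ t ω * α ^ t) κ) atTop (nhds 0) :=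
        squeeze_zero (fun t => hε0 t ω) (fun t => min_le_left _ _) hω
      simpa using h2.mul_const (ζ ω)
  -- the contribution of the disturbances
  have hdist : ∀ t, eLpNorm (fun ω => Γ t ω * accumulatedForcing α ρ₀ φ w θ t ω)
      (ENNReal.ofReal p) μ ≤ B * (R * σ) := by
    intro t
    -- Hölder with 1/(3p) + 2/(3p) = 1/p.
    refine (eLpNorm_mul_le_ofReal (a := 3 * p) (b := 3 * p / 2) (by linarith) (by linarith)
      hp0 (by field_simp; norm_num) (hΓm t).aestronglyMeasurable
      (hνm t).aestronglyMeasurable).trans (mul_le_mul' (hBT _) ?_)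
    refine (eLpNorm_accumulatedForcing_le hn hφm hw hθ hp hα0 hα1 ρ₀ t).trans (le_of_eq ?_)
    simp only [R, σ, mul_assoc]
  have hbound : ∀ᶠ t in atTop, LNorm μ p (trackingError G α P₀ θ₀ φ y θ t) ≤
      C * σ + n * eLpNorm (ε t) (ENNReal.ofReal p) μ := by
    filter_upwards [eventually_ge_atTop (h + G.diameter + 1)] with t ht
    refine (eLpNorm_mono_real (g := (n : ℝ) • ((fun ω => Γ t ω *
      accumulatedForcing α ρ₀ φ w θ t ω) + ε t)) fun ω => herr φ θ w y θ₀ hy t ht ω).trans ?_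
    rw [eLpNorm_const_smul, Real.enorm_natCast]
    refine (mul_le_mul_right ((eLpNorm_add_le ((hΓm t).mul (hνm t)).aestronglyMeasurable
      (hεm t).aestronglyMeasurable hpE).trans (add_le_add_left (hdist t) _)) _).trans
      (le_of_eq ?_)
    simp only [C]
    ring
  have hlim : Tendsto (fun t => C * σ + n * eLpNorm (ε t) (ENNReal.ofReal p) μ) atTop
      (nhds (C * σ)) := by
    have h1 := ENNReal.Tendsto.const_mul (a := (n : ℝ≥0∞)) hεlim
      (Or.inr (ENNReal.natCast_ne_top n))
    simpa using h1.const_add (C * σ)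
  refine (limsup_le_limsup hbound).trans ?_
  rw [hlim.limsup_eq]
  refine mul_le_mul_left ?_ σ
  rw [← ENNReal.ofReal_toReal hC, ENNReal.toReal_ofReal ENNReal.toReal_nonneg]
  exact ENNReal.ofReal_le_ofReal (by linarith)
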